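/- \textbf{Setting.} Let $A\in\mathbb R^{m\times n}$ be a random matrix with i.i.d. entries that are centred Gaussian or, more generally, sub-Gaussian: the entries have variance $\sigma^2>0$ and $\mathbb E\,e^{tA_{ik}}\le e^{\kappa\sigma^2t^2/2}$ for all $t\in\mathbb R$ (so they have mean zero; $\kappa=1$ for centred Gaussian entries). Independently of $A$, draw $K\ge 1$ bootstrap samples $\mathcal I_1,\dots,\mathcal I_K$, each consisting of $L$ independent uniform draws with replacement from $\{1,\dots,m\}$. Let $V(\mathcal I)$ be the number of distinct elements of a multiset $\mathcal I$ and write $A[\mathcal I]$ for the matrix of the rows of $A$ with indices in $\mathcal I$. Let $A^J$ be the block diagonal matrix whose $j$-th block consists of the distinct rows of $A[\mathcal I_j]$. Its columns are indexed by pairs $(i,j)$, $i\le n$, $j\le K$, and $\mathcal B=\{\mathcal B_1,\dots,\mathcal B_n\}$, $\mathcal B_i=\{(i,j): j\le K\}$, is the row partition. Let $\delta_{r|\mathcal B}(A^J)$ be the block restricted isometry constant after $\ell_2$-normalisation of columns: if $\bar A^J$ is $A^J$ with every nonzero column divided by its Euclidean norm, it is the least $\delta\ge0$ such that $(1-\delta)\|v\|_2^2\le\|\bar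 A^Jv\|_2^2\le(1+\delta)\|v\|_2^2$ for all $v$ that are nonzero on at most $r$ of the blocks $\mathcal B_i$. For noiseless measurements $y=Ax$, JOBS solves $$\min_{X=(x_1,\dots,x_K)\in\mathbb R^{n\times K}}\ \sum_{i=1}^n\Big(\sum_{j=1}^KX_{ij}^2\Big)^{1/2}\quad\text{subject to}\quad y[\mathcal I_j]=A[\mathcal I_j]\,x_j,\ j=1,\dots,K,$$ and returns the average $x^J=\frac1K\sum_jx_j$ of the columns of a solution. \textbf{Theorem (Sample complexity for JOBS).} For all $\kappa\ge 0$ and $\rho>1$ there is a constant $\beta>0$ depending only on $\kappa$ and $\rho$ such that the following holds. Let $s\ge1$ with $n\ge\rho\cdot 2s$, let $0\le\alpha<1$ and $0<\mu<1$ with $(1-\alpha)^K>1-\mu$, and let $d\in\mathbb N$ be such that $\mathbb P\{V(\mathcal I_j)\ge d\}\ge1-\alpha$ for every $j$. If $$d\ \ge\ \beta\left(2s\ln\frac{n}{2s}+\ln K+\ln\frac{(1-\alpha)^K}{(1-\alpha)^K-(1-\mu)}\right),$$ then, with probability at least $1-\mu$, both $\delta_{2s|\mathcal B}(A^J)<\sqrt2-1$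 and JOBS recovers all $s$-sparse vectors: for every $s$-sparse $x\in\mathbb R^n$ and $y=Ax$, the JOBS program has the unique solution $X^\star=(x,\dots,x)$, so that $x^J=x$. In particular $\mathbb P\{\delta_{2s|\mathcal B}(A^J)<\sqrt2-1\}\ge1-\mu$, and JOBS recovers the true $s$-sparse solution with probability at least $1-\mu$. -/

import Mathlib

open MeasureTheory ProbabilityTheory
open scoped NNReal Matrix

noncomputable section

namespace Jobs

/-- `ν` is a nondegenerate sub-Gaussian law on the line: it has variance `σ² > 0` and
`∫ exp (t x) dν ≤ exp (κ σ² t² / 2)` for all real `t` (in particular it has mean zero).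
The number `κ` is scale invariant. -/
def IsSubgaussianLaw (κ : ℝ≥0) (ν : Measure ℝ) : Prop :=
  0 < Var[id; ν] ∧ HasSubgaussianMGF id (κ * Var[id; ν].toNNReal) ν

/-- Every nondegenerate centred Gaussian law is sub-Gaussian with `κ = 1`. -/
theorem isSubgaussianLaw_gaussianReal {v : ℝ≥0} (hv : v ≠ 0) :
    IsSubgaussianLaw 1 (gaussianReal 0 v) := by
  refine ⟨?_, ?_, ?_⟩
  · rw [variance_id_gaussianReal]
    exact_mod_cast pos_iff_ne_zero.mpr hv
  · intro t
    exact integrable_exp_mul_gaussianReal t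
  · intro t
    rw [mgf_id_gaussianReal, variance_id_gaussianReal]
    simp

/-- Number of distinct elements of the multiset `{I 0, …, I (L - 1)}`. -/
def numDistinct {L m : ℕ} (I : Fin L → Fin m) : ℕ :=
  (Finset.univ.image I).card

/-- The rows of `A` whose index occurs in the multiset `I`, each taken once. -/
def distinctRows {L m n : ℕ} (A : Matrix (Fin m) (Fin n) ℝ) (I : Fin L → Fin m) :
    Matrix (Finset.univ.image I) (Fin n) ℝ :=
  A.submatrix Subtype.val id

/-- The block diagonal matrix with the `K` blocks `distinctRows A (I j)`. A column index
`⟨j, i⟩` stands for the entry in row `i` and column `j` of an `n × K` matrix of unknowns. -/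
def jobsMatrix {K L m n : ℕ} (A : Matrix (Fin m) (Fin n) ℝ) (I : Fin K → Fin L → Fin m) :
    Matrix (Σ j : Fin K, (Finset.univ.image (I j) : Finset (Fin m))) (Σ _ : Fin K, Fin n) ℝ :=
  Matrix.blockDiagonal' fun j => distinctRows A (I j)

/-- `M Q(M)`: every nonzero column of `M` divided by its Euclidean norm. -/
def colNormalize {R C : Type*} [Fintype R] [Fintype C] [DecidableEq C] (M : Matrix R C ℝ) :
    Matrix R C ℝ :=
  M * Matrix.diagonal fun c => (√(∑ r, M r c ^ 2))⁻¹

/-- `v` has at most `s` nonzero blocks, for the partition of the coordinates into the fibres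
of `b`. -/
def IsBlockSparse {C B : Type*} (b : C → B) (s : ℕ) (v : C → ℝ) : Prop :=
  (b '' {c | v c ≠ 0}).encard ≤ s

/-- Block restricted isometry constant of order `s` of `M`: the least `δ ≥ 0` such that
`(1 - δ) ‖v‖₂² ≤ ‖M v‖₂² ≤ (1 + δ) ‖v‖₂²` for all `v` with at most `s` nonzero blocks. -/
def blockRIPConst {R C B : Type*} [Fintype R] [Fintype C] (b : C → B) (s : ℕ)
    (M : Matrix R C ℝ) : ℝ :=
  sInf {δ : ℝ | 0 ≤ δ ∧ ∀ v : C → ℝ, IsBlockSparse b s v →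
    (1 - δ) * ∑ c, v c ^ 2 ≤ ∑ r, (M *ᵥ v) r ^ 2 ∧
      ∑ r, (M *ᵥ v) r ^ 2 ≤ (1 + δ) * ∑ c, v c ^ 2}

/-- `δ_{s|𝓑}(A^J)`: the block restricted isometry constant of the column-normalised block
diagonal matrix; the block `𝓑_i` consists of the `K` coordinates in row `i` of the unknown. -/
def jobsRIPConst {K L m n : ℕ} (s : ℕ) (A : Matrix (Fin m) (Fin n) ℝ)
    (I : Fin K → Fin L → Fin m) : ℝ :=
  blockRIPConst (fun p : Σ _ : Fin K, Fin n => p.2) s (colNormalize (jobsMatrix A I))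

/-- The mixed norm `‖X‖_{1,2}`: the sum of the Euclidean norms of the rows of `X`. -/
def normOneTwo {n K : ℕ} (X : Matrix (Fin n) (Fin K) ℝ) : ℝ :=
  ∑ i, √(∑ j, X i j ^ 2)

/-- The feasible set of `J₁₂`: `y[I_j] = A[I_j] x_j` for every column `x_j` of `X`, where the
rows are taken with their multiplicities. -/
def jobsFeasible {K L m n : ℕ} (A : Matrix (Fin m) (Fin n) ℝ) (I : Fin K → Fin L → Fin m)
    (y : Fin m → ℝ) : Set (Matrix (Fin n) (Fin K) ℝ) :=
  {X | ∀ j, A.submatrix (I j) id *ᵥ (fun i => X i j) = fun l => y (I j l)}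

/-- `X` solves `J₁₂`: it minimises `‖X‖_{1,2}` over the feasible set. -/
def IsJobsMinimizer {K L m n : ℕ} (A : Matrix (Fin m) (Fin n) ℝ) (I : Fin K → Fin L → Fin m)
    (y : Fin m → ℝ) (X : Matrix (Fin n) (Fin K) ℝ) : Prop :=
  X ∈ jobsFeasible A I y ∧ IsMinOn normOneTwo (jobsFeasible A I y) X

/-- The JOBS estimate: the average of the columns of `X`. -/
def jobsEstimate {n K : ℕ} (X : Matrix (Fin n) (Fin K) ℝ) : Fin n → ℝ :=
  fun i => (1 / (K : ℝ)) * ∑ j, X i j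

/-- From the noiseless measurements `y = A x` of any `s`-sparse `x`, the program `J₁₂` has the
unique solution `(x, …, x)` and the JOBS estimate obtained from it is `x`. -/
def JobsRecovers {K L m n : ℕ} (s : ℕ) (A : Matrix (Fin m) (Fin n) ℝ)
    (I : Fin K → Fin L → Fin m) : Prop :=
  ∀ x : Fin n → ℝ, {i | x i ≠ 0}.encard ≤ s →
    ∀ X : Matrix (Fin n) (Fin K) ℝ,
      (IsJobsMinimizer A I (A *ᵥ x) X ↔ X = Matrix.of fun i _ => x i) ∧
      (IsJobsMinimizer A I (A *ᵥ x) X → jobsEstimate X = x)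

end Jobs

end

/-! Condition on the bootstrap samples. If every sample has at least `d` distinct indices, each
block of the measurement matrix consists of at least `d` rows of `A`, still i.i.d. sub-Gaussian
because `A` is independent of `I`. For one block and one fixed vector, the squared row products are
independent with equal means, and Chernoff's bound makes their sum concentrate at an exponential
rate in the number of rows (`measure_not_rowsNear_le`). A finite net of the `2s`-sparse vectors,
chosen before `A` (`exists_net_rowsRIP`), and a union bound over net points and over the `K` blocks,
which may share rows, give a restricted isometry property for all blocks at once. The samples are
good with probability at least `(1 - α) ^ K`, and `β` makes the conditional failure probability at
most `D`, where `(1 - D) * (1 - α) ^ K = 1 - μ`.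

The rest is deterministic. Isometry on each block bounds the constant of the column-normalised
matrix by `2/9` (`jobsRIPConst_le_of_rowsRIP`). Recovery does not go through that matrix, since
normalising columns would reweight the objective. Instead each block is rescaled as a whole, which
keeps its equations equivalent; the rescaled map has block constant `1/10 < 1/3`, hence the block
null space property (`BlockRIP.two_mul_sum_lt`), and `(x, …, x)` is the unique minimiser. -/

noncomputable section

namespace ProbabilityTheory

/-! ### Concentration of sums of squares of sub-Gaussian variables -/

section Concentration

variable {Ω : Type*} [MeasurableSpace Ω] {P : Measure Ω} [IsProbabilityMeasure P]

/-- A sub-Gaussian random variable is centred. -/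
theorem HasSubgaussianMGF.integral_eq_zero {X : Ω → ℝ} {c : ℝ≥0} (h : HasSubgaussianMGF X c P) :
    ∫ ω, X ω ∂P = 0 := by
  have hle : ∀ t : ℝ, 0 ≤ Real.exp (c * t ^ 2 / 2) - 1 - t * ∫ ω, X ω ∂P := by
    intro t
    have h1 : ∫ ω, (t * X ω + 1) ∂P ≤ ∫ ω, Real.exp (t * X ω) ∂P :=
      integral_mono ((h.integrable.const_mul t).add (integrable_const 1))
        (h.integrable_exp_mul t) fun ω => Real.add_one_le_exp _
    rw [integral_add (h.integrable.const_mul t) (integrable_const 1), integral_const_mul] at h1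
    have h2 := h.mgf_le t
    simp only [mgf, integral_const, probReal_univ, smul_eq_mul, mul_one] at h1 h2
    linarith
  -- The nonnegative difference vanishes at `t = 0`, so its derivative there, minus the mean, is
  -- zero.
  have hmin : IsLocalMin
      (fun t : ℝ => Real.exp (c * t ^ 2 / 2) - 1 - t * ∫ ω, X ω ∂P) 0 :=
    Filter.Eventually.of_forall fun t => by simpa using hle t
  have hd : HasDerivAt (fun t : ℝ => Real.exp (c * t ^ 2 / 2) - 1 - t * ∫ ω, X ω ∂P)
      (Real.exp (c * 0 ^ 2 / 2) * (c * (2 * 0) / 2) - 1 * ∫ ω, X ω ∂P) 0 := by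
    refine HasDerivAt.sub (HasDerivAt.sub_const _ (HasDerivAt.exp ?_))
      ((hasDerivAt_id (0 : ℝ)).mul_const _)
    have := (hasDerivAt_pow 2 (0 : ℝ)).const_mul (c : ℝ) |>.div_const 2
    simpa using this
  have := hmin.hasDerivAt_eq_zero hd
  simpa using this

/-- The exact value is `√2`. -/
theorem lintegral_exp_sq_div_four_gaussianReal :
    ∫⁻ x, ENNReal.ofReal (Real.exp (x ^ 2 / 4)) ∂(gaussianReal 0 1) ≤ 2 := by
  rw [gaussianReal_of_var_ne_zero _ one_ne_zero,
    lintegral_withDensity_eq_lintegral_mul _ (measurable_gaussianPDF 0 1) (by fun_prop)]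
  have h1 : ∀ x : ℝ, (gaussianPDF 0 1 * fun x => ENNReal.ofReal (Real.exp (x ^ 2 / 4))) x =
      ENNReal.ofReal ((√(2 * Real.pi))⁻¹ * Real.exp (-(1 / 4) * x ^ 2)) := by
    intro x
    simp only [Pi.mul_apply, gaussianPDF, gaussianPDFReal]
    rw [← ENNReal.ofReal_mul (by positivity), mul_assoc, ← Real.exp_add]
    congr 2
    · simp
    · congr 1; simp; ring
  simp_rw [h1]
  rw [← ofReal_integral_eq_lintegral_ofReal
    ((integrable_exp_neg_mul_sq (by norm_num)).const_mul _)
    (Filter.Eventually.of_forall fun x => by positivity),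
    integral_const_mul, integral_gaussian]
  rw [show (2 : ENNReal) = ENNReal.ofReal 2 by simp]
  apply ENNReal.ofReal_le_ofReal
  have hpi := Real.pi_pos
  rw [inv_mul_le_iff₀ (by positivity)]
  apply Real.sqrt_le_iff.2 ⟨by positivity, ?_⟩
  rw [mul_pow, Real.sq_sqrt (by positivity)]
  linarith

/-- Gaussian linearisation: `exp (a x²)` is the mean of `exp (√(2a) x g)` over a standard normal
`g`. After swapping integrals, the bound on the moment generating function leaves `exp (a c g²) ≤
exp (g² / 4)`. -/
theorem HasSubgaussianMGF.lintegral_exp_sq_le {X : Ω → ℝ} {c : ℝ≥0} (h : HasSubgaussianMGF X c P)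
    {a : ℝ} (ha : 0 ≤ a) (hac : 4 * a * c ≤ 1) :
    ∫⁻ ω, ENNReal.ofReal (Real.exp (a * X ω ^ 2)) ∂P ≤ 2 := by
  have h1 : ∀ x : ℝ, ENNReal.ofReal (Real.exp (a * x ^ 2)) =
      ∫⁻ g, ENNReal.ofReal (Real.exp (√(2 * a) * x * g)) ∂(gaussianReal 0 1) := by
    intro x
    rw [← ofReal_integral_eq_lintegral_ofReal (integrable_exp_mul_gaussianReal _)
      (Filter.Eventually.of_forall fun _ => (Real.exp_pos _).le)]
    have := congrFun (mgf_id_gaussianReal (μ := 0) (v := 1)) (√(2 * a) * x)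
    simp only [mgf, id] at this
    rw [this, mul_pow, Real.sq_sqrt (by positivity)]
    congr 2
    simp; ring
  simp_rw [h1]
  rw [lintegral_lintegral_swap]
  · refine (lintegral_mono fun g => ?_).trans lintegral_exp_sq_div_four_gaussianReal
    have h2 : ∀ ω, √(2 * a) * X ω * g = (√(2 * a) * g) * X ω := fun ω => by ring
    simp_rw [h2]
    rw [← ofReal_integral_eq_lintegral_ofReal (h.integrable_exp_mul _)
      (Filter.Eventually.of_forall fun _ => (Real.exp_pos _).le)]
    refine ENNReal.ofReal_le_ofReal ((h.mgf_le _).trans (Real.exp_le_exp.2 ?_))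
    rw [mul_pow, Real.sq_sqrt (by positivity)]
    nlinarith [sq_nonneg g]
  · have := h.aemeasurable
    exact ((((this.comp_fst (ν := gaussianReal 0 1)).const_mul _).mul
      (measurable_snd.aemeasurable)).exp).ennreal_ofReal

theorem HasSubgaussianMGF.integrable_exp_sq {X : Ω → ℝ} {c : ℝ≥0} (h : HasSubgaussianMGF X c P)
    {a : ℝ} (ha : 0 ≤ a) (hac : 4 * a * c ≤ 1) :
    Integrable (fun ω => Real.exp (a * X ω ^ 2)) P := by
  have hm : AEMeasurable (fun ω => Real.exp (a * X ω ^ 2)) P :=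
    ((h.aemeasurable.pow_const 2).const_mul a).exp
  refine ⟨hm.aestronglyMeasurable, ?_⟩
  rw [hasFiniteIntegral_iff_ofReal (Filter.Eventually.of_forall fun _ => (Real.exp_pos _).le)]
  exact (h.lintegral_exp_sq_le ha hac).trans_lt (by simp)

theorem HasSubgaussianMGF.integral_exp_sq_le {X : Ω → ℝ} {c : ℝ≥0} (h : HasSubgaussianMGF X c P)
    {a : ℝ} (ha : 0 ≤ a) (hac : 4 * a * c ≤ 1) :
    ∫ ω, Real.exp (a * X ω ^ 2) ∂P ≤ 2 := by
  have h1 := h.lintegral_exp_sq_le ha hac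
  rw [← ofReal_integral_eq_lintegral_ofReal (h.integrable_exp_sq ha hac)
    (Filter.Eventually.of_forall fun _ => (Real.exp_pos _).le)] at h1
  rwa [show (2 : ENNReal) = ENNReal.ofReal 2 by simp,
    ENNReal.ofReal_le_ofReal_iff (by norm_num)] at h1

theorem _root_.Real.exp_le_one_add_add_sq_mul_exp_abs (u : ℝ) :
    Real.exp u ≤ 1 + u + u ^ 2 * Real.exp |u| := by
  have h := Complex.norm_exp_sub_sum_le_norm_mul_exp (u : ℂ) 2
  have h1 : Complex.exp u - ∑ m ∈ Finset.range 2, (u : ℂ) ^ m / m.factorial =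
      ((Real.exp u - (1 + u) : ℝ) : ℂ) := by
    simp [Finset.sum_range_succ]
  rw [h1, Complex.norm_real, Complex.norm_real, Real.norm_eq_abs, Real.norm_eq_abs, sq_abs] at h
  have := le_abs_self (Real.exp u - (1 + u))
  linarith

/-- The quadratic coefficient in the bound on the cumulant generating function of `X ^ 2 - 1`. -/
def sqCumulantConst (κ : ℝ) : ℝ := 256 * κ ^ 2 * Real.exp (1 / (4 * κ))

theorem sqCumulantConst_pos {κ : ℝ} (hκ : 0 < κ) : 0 < sqCumulantConst κ := by
  unfold sqCumulantConst; positivity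

/-- In the Taylor remainder, the factor `y²` and the factor `exp |l y|` each cost one `exp (|y| /
(8κ))`. Their product reaches exactly the exponent `1 / (4κ)` at which the square of a sub-Gaussian
variable still has exponential moment at most 2. -/
theorem _root_.Real.exp_mul_sq_sub_one_le {κ l x : ℝ} (hκ : 0 < κ) (hl : |l| ≤ 1 / (8 * κ)) :
    Real.exp (l * (x ^ 2 - 1)) ≤ 1 + l * (x ^ 2 - 1) +
      128 * κ ^ 2 * Real.exp (1 / (4 * κ)) * l ^ 2 * Real.exp (1 / (4 * κ) * x ^ 2) := by
  refine (Real.exp_le_one_add_add_sq_mul_exp_abs _).trans ?_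
  set y := x ^ 2 - 1 with hy
  have hyle : |y| ≤ 1 + x ^ 2 := by rw [abs_le]; constructor <;> nlinarith [sq_nonneg x]
  have h1 : (|y| / (8 * κ)) ^ 2 / 2 ≤ Real.exp (|y| / (8 * κ)) := by
    have := Real.pow_div_factorial_le_exp (x := |y| / (8 * κ)) (by positivity) 2
    simpa using this
  have h2 : y ^ 2 ≤ 128 * κ ^ 2 * Real.exp (|y| / (8 * κ)) := by
    rw [div_pow, sq_abs, div_div, div_le_iff₀ (by positivity)] at h1
    nlinarith
  have h3 : Real.exp |l * y| ≤ Real.exp (|y| / (8 * κ)) := by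
    apply Real.exp_le_exp.2
    rw [abs_mul, div_eq_mul_one_div, mul_comm]
    exact mul_le_mul_of_nonneg_left hl (abs_nonneg _)
  have h4 : Real.exp (|y| / (8 * κ)) * Real.exp (|y| / (8 * κ)) ≤
      Real.exp (1 / (4 * κ)) * Real.exp (1 / (4 * κ) * x ^ 2) := by
    rw [← Real.exp_add, ← Real.exp_add]
    apply Real.exp_le_exp.2
    have : |y| / (8 * κ) + |y| / (8 * κ) = 1 / (4 * κ) * |y| := by field_simp; ring
    rw [this, ← mul_one_add]
    exact mul_le_mul_of_nonneg_left hyle (by positivity)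
  have : (l * y) ^ 2 * Real.exp |l * y| ≤
      128 * κ ^ 2 * Real.exp (1 / (4 * κ)) * l ^ 2 * Real.exp (1 / (4 * κ) * x ^ 2) := by
    calc (l * y) ^ 2 * Real.exp |l * y|
        = l ^ 2 * (y ^ 2 * Real.exp |l * y|) := by ring
      _ ≤ l ^ 2 * (128 * κ ^ 2 * Real.exp (|y| / (8 * κ)) * Real.exp (|y| / (8 * κ))) := by
          gcongr
      _ = l ^ 2 * (128 * κ ^ 2) * (Real.exp (|y| / (8 * κ)) * Real.exp (|y| / (8 * κ))) := by ring
      _ ≤ l ^ 2 * (128 * κ ^ 2) * (Real.exp (1 / (4 * κ)) * Real.exp (1 / (4 * κ) * x ^ 2)) := by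
          gcongr
      _ = _ := by ring
  linarith

theorem HasSubgaussianMGF.integrable_exp_mul_sq_sub_one {X : Ω → ℝ} {κ : ℝ≥0} (hκ : 0 < κ)
    (h : HasSubgaussianMGF X κ P) {l : ℝ} (hl : |l| ≤ 1 / (8 * κ)) :
    Integrable (fun ω => Real.exp (l * (X ω ^ 2 - 1))) P := by
  have hκ' : (0 : ℝ) < κ := hκ
  have hm : AEMeasurable (fun ω => Real.exp (l * (X ω ^ 2 - 1))) P :=
    (((h.aemeasurable.pow_const 2).sub_const 1).const_mul l).exp
  have hi := (h.integrable_exp_sq (a := 1 / (4 * κ)) (by positivity)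
    (by field_simp; norm_num)).const_mul (Real.exp (1 / (8 * κ)))
  refine hi.mono' hm.aestronglyMeasurable (Filter.Eventually.of_forall fun ω => ?_)
  rw [Real.norm_of_nonneg (Real.exp_pos _).le, ← Real.exp_add]
  apply Real.exp_le_exp.2
  have h8 : 1 / (4 * (κ : ℝ)) = 2 * (1 / (8 * κ)) := by field_simp; norm_num
  rw [h8]
  have := abs_le.1 hl
  nlinarith [sq_nonneg (X ω)]

/-- The linear term integrates to zero since the second moment is one, so only a term quadratic in
`l` remains. -/
theorem HasSubgaussianMGF.mgf_sq_sub_one_le {X : Ω → ℝ} {κ : ℝ≥0} (hκ : 0 < κ)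
    (h : HasSubgaussianMGF X κ P) (h2 : ∫ ω, X ω ^ 2 ∂P = 1) {l : ℝ} (hl : |l| ≤ 1 / (8 * κ)) :
    mgf (fun ω => X ω ^ 2 - 1) P l ≤ Real.exp (sqCumulantConst κ * l ^ 2) := by
  have hκ' : (0 : ℝ) < κ := hκ
  have hac : 4 * (1 / (4 * (κ : ℝ))) * κ ≤ 1 := by field_simp; norm_num
  have hX2 : Integrable (fun ω => X ω ^ 2) P := (h.memLp 2).integrable_sq
  have hi := (h.integrable_exp_sq (a := 1 / (4 * κ)) (by positivity) hac).const_mul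
    (128 * (κ : ℝ) ^ 2 * Real.exp (1 / (4 * κ)) * l ^ 2)
  have hi1 : Integrable (fun ω => 1 + l * (X ω ^ 2 - 1)) P :=
    (integrable_const 1).add ((hX2.sub (integrable_const 1)).const_mul l)
  have hb := integral_mono (h.integrable_exp_mul_sq_sub_one hκ hl) (hi1.add hi)
    fun ω => Real.exp_mul_sq_sub_one_le (x := X ω) hκ' hl
  have hv : ∫ ω, (1 + l * (X ω ^ 2 - 1)) ∂P = 1 := by
    have hs : Integrable (fun ω => X ω ^ 2 - 1) P := hX2.sub (integrable_const 1)
    rw [integral_add (integrable_const 1) (hs.const_mul l), integral_const_mul, integral_sub hX2 (integrable_const 1), h2]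
    simp
  have he := h.integral_exp_sq_le (a := 1 / (4 * κ)) (by positivity) hac
  simp only [Pi.add_apply] at hb
  rw [integral_add hi1 hi, hv, integral_const_mul] at hb
  refine hb.trans ?_
  calc 1 + 128 * (κ : ℝ) ^ 2 * Real.exp (1 / (4 * κ)) * l ^ 2 *
        ∫ ω, Real.exp (1 / (4 * κ) * X ω ^ 2) ∂P
      ≤ 1 + 128 * (κ : ℝ) ^ 2 * Real.exp (1 / (4 * κ)) * l ^ 2 * 2 := by gcongr
    _ = sqCumulantConst κ * l ^ 2 + 1 := by unfold sqCumulantConst; ring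
    _ ≤ _ := Real.add_one_le_exp _

/-- Parameter for the Chernoff bound of a sum of squares of sub-Gaussian variables. -/
def chernoffParam (κ t : ℝ) : ℝ := min (1 / (8 * κ)) (t / (2 * sqCumulantConst κ))

/-- Exponential rate of concentration of a sum of squares of sub-Gaussian variables. -/
def concentrationRate (κ t : ℝ) : ℝ := chernoffParam κ t * t / 2

theorem chernoffParam_pos {κ t : ℝ} (hκ : 0 < κ) (ht : 0 < t) : 0 < chernoffParam κ t :=
  lt_min (by positivity) (div_pos ht (mul_pos two_pos (sqCumulantConst_pos hκ)))

theorem concentrationRate_pos {κ t : ℝ} (hκ : 0 < κ) (ht : 0 < t) : 0 < concentrationRate κ t :=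
  div_pos (mul_pos (chernoffParam_pos hκ ht) ht) two_pos

section Sum

variable {ι : Type*} {X : ι → Ω → ℝ} {κ : ℝ≥0}

theorem mgf_sum_sq_sub_one_le (hκ : 0 < κ) (hX : ∀ i, HasSubgaussianMGF (X i) κ P)
    (h2 : ∀ i, ∫ ω, X i ω ^ 2 ∂P = 1) (hind : iIndepFun X P) (T : Finset ι)
    {l : ℝ} (hl : |l| ≤ 1 / (8 * κ)) :
    Integrable (fun ω => Real.exp (l * (∑ i ∈ T, X i ω ^ 2 - T.card))) P ∧
    mgf (fun ω => ∑ i ∈ T, X i ω ^ 2 - T.card) P l ≤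
      Real.exp (sqCumulantConst κ * l ^ 2 * T.card) := by
  have hind' : iIndepFun (fun i ω => X i ω ^ 2 - 1) P :=
    hind.comp (fun _ x => x ^ 2 - 1) fun _ => by fun_prop
  have hm : ∀ i, AEMeasurable (fun ω => X i ω ^ 2 - 1) P := fun i =>
    ((hX i).aemeasurable.pow_const 2).sub_const 1
  have hs := hind'.mgf_sum₀ (t := l) hm T
  have hf : (∑ i ∈ T, fun ω => X i ω ^ 2 - 1) = fun ω => ∑ i ∈ T, X i ω ^ 2 - T.card := by
    ext ω; simp
  rw [hf] at hs
  constructor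
  -- Integrability is equivalent to positivity of the moment generating function, which factorises.
  · rw [← mgf_pos_iff (X := fun ω => ∑ i ∈ T, X i ω ^ 2 - T.card), hs]
    exact Finset.prod_pos fun i _ =>
      mgf_pos_iff.2 ((hX i).integrable_exp_mul_sq_sub_one hκ hl)
  · rw [hs, mul_comm _ (T.card : ℝ), Real.exp_nat_mul]
    exact (Finset.prod_le_prod (fun i _ => mgf_nonneg) fun i _ =>
      (hX i).mgf_sq_sub_one_le hκ (h2 i) hl).trans_eq (Finset.prod_const _)

theorem chernoff_exponent_le {κ t N : ℝ} (hκ : 0 < κ) (ht : 0 < t) (hN : 0 ≤ N) :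
    -chernoffParam κ t * (t * N) + sqCumulantConst κ * chernoffParam κ t ^ 2 * N ≤
      -(concentrationRate κ t * N) := by
  have hl := chernoffParam_pos hκ ht
  have hD := sqCumulantConst_pos hκ
  -- This branch of the minimum keeps the quadratic term below half the linear one; the other branch
  -- keeps the parameter in the range of the cumulant bound.
  have h1 : chernoffParam κ t ≤ t / (2 * sqCumulantConst κ) := min_le_right _ _
  rw [le_div_iff₀ (by positivity)] at h1
  have h2 : sqCumulantConst κ * chernoffParam κ t ^ 2 ≤ chernoffParam κ t * t / 2 := by nlinarith
  have := mul_le_mul_of_nonneg_right h2 hN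
  unfold concentrationRate
  nlinarith

theorem measure_sum_sq_ge_le (hκ : 0 < κ) (hX : ∀ i, HasSubgaussianMGF (X i) κ P)
    (h2 : ∀ i, ∫ ω, X i ω ^ 2 ∂P = 1) (hind : iIndepFun X P) (T : Finset ι)
    {t : ℝ} (ht : 0 < t) :
    P.real {ω | (1 + t) * T.card ≤ ∑ i ∈ T, X i ω ^ 2} ≤
      Real.exp (-(concentrationRate κ t * T.card)) := by
  have hκ' : (0 : ℝ) < κ := hκ
  have hl := chernoffParam_pos hκ' ht
  obtain ⟨hi, hm⟩ := mgf_sum_sq_sub_one_le hκ hX h2 hind T (l := chernoffParam κ t)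
    (by rw [abs_of_pos hl]; exact min_le_left _ _)
  have := measure_ge_le_exp_mul_mgf (t * T.card) hl.le hi
  refine (le_of_eq ?_).trans (this.trans ?_)
  · congr 1; ext ω; simp only [Set.mem_ofPred_eq]; constructor <;> intro h <;> linarith
  · refine (mul_le_mul_of_nonneg_left hm (Real.exp_pos _).le).trans ?_
    rw [← Real.exp_add]
    exact Real.exp_le_exp.2 (chernoff_exponent_le hκ' ht (by positivity))

theorem measure_sum_sq_le_le (hκ : 0 < κ) (hX : ∀ i, HasSubgaussianMGF (X i) κ P)
    (h2 : ∀ i, ∫ ω, X i ω ^ 2 ∂P = 1) (hind : iIndepFun X P) (T : Finset ι)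
    {t : ℝ} (ht : 0 < t) :
    P.real {ω | ∑ i ∈ T, X i ω ^ 2 ≤ (1 - t) * T.card} ≤
      Real.exp (-(concentrationRate κ t * T.card)) := by
  have hκ' : (0 : ℝ) < κ := hκ
  have hl := chernoffParam_pos hκ' ht
  obtain ⟨hi, hm⟩ := mgf_sum_sq_sub_one_le hκ hX h2 hind T (l := -chernoffParam κ t)
    (by rw [abs_neg, abs_of_pos hl]; exact min_le_left _ _)
  have := measure_le_le_exp_mul_mgf (-(t * T.card)) (neg_nonpos.2 hl.le) hi
  refine (le_of_eq ?_).trans (this.trans ?_)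
  · congr 1; ext ω; simp only [Set.mem_ofPred_eq]; constructor <;> intro h <;> linarith
  · refine (mul_le_mul_of_nonneg_left hm (Real.exp_pos _).le).trans ?_
    rw [← Real.exp_add]
    refine Real.exp_le_exp.2 (le_trans (le_of_eq ?_)
      (chernoff_exponent_le hκ' ht (Nat.cast_nonneg T.card)))
    ring

end Sum

end Concentration

end ProbabilityTheory

end

noncomputable section

namespace Jobs

/-! ### Nets in finite-dimensional normed spaces -/

section Nets

/-- Halve a maximal 1-separated subset of the ball of radius 2. The Besicovitch packing bound limits
its size, and by maximality `2x` is within distance 1 of it. -/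
theorem exists_half_net (E : Type*) [NormedAddCommGroup E] [NormedSpace ℝ E]
    [FiniteDimensional ℝ E] :
    ∃ N : Finset E, N.card ≤ 5 ^ Module.finrank ℝ E ∧
      ∀ x : E, ‖x‖ ≤ 1 → ∃ p ∈ N, ‖x - p‖ ≤ 1 / 2 := by
  classical
  let Sep : Finset E → Prop := fun s =>
    (∀ c ∈ s, ‖c‖ ≤ 2) ∧ ∀ c ∈ s, ∀ d ∈ s, c ≠ d → 1 ≤ ‖c - d‖
  let S : Set ℕ := {k | ∃ s : Finset E, Sep s ∧ s.card = k}
  have hne : S.Nonempty := ⟨0, ∅, ⟨by simp, by simp⟩, rfl⟩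
  have hbd : BddAbove S := ⟨5 ^ Module.finrank ℝ E, by
    rintro k ⟨s, hs, rfl⟩
    exact Besicovitch.card_le_of_separated s hs.1 hs.2⟩
  obtain ⟨s, hs, hcard⟩ := Nat.sSup_mem hne hbd
  refine ⟨s.image fun c => (1 / 2 : ℝ) • c,
    Finset.card_image_le.trans (Besicovitch.card_le_of_separated s hs.1 hs.2), fun x hx => ?_⟩
  by_cases h : ∃ c ∈ s, ‖(2 : ℝ) • x - c‖ < 1
  · obtain ⟨c, hc, hlt⟩ := h
    refine ⟨_, Finset.mem_image_of_mem _ hc, ?_⟩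
    have : x - (1 / 2 : ℝ) • c = (1 / 2 : ℝ) • ((2 : ℝ) • x - c) := by
      rw [smul_sub, smul_smul]; norm_num
    rw [this, norm_smul]
    norm_num
    linarith
  · push Not at h
    exfalso
    have hmem : (2 : ℝ) • x ∉ s := fun hm => by have := h _ hm; simp at this; linarith
    have hsep : Sep (insert ((2 : ℝ) • x) s) := by
      constructor
      · intro c hc
        rcases Finset.mem_insert.1 hc with rfl | hc
        · rw [norm_smul]; norm_num; exact hx
        · exact hs.1 c hc
      · intro c hc d hd hcd
        rcases Finset.mem_insert.1 hc with rfl | hc <;> rcases Finset.mem_insert.1 hd with rfl | hd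
        · exact absurd rfl hcd
        · exact h d hd
        · rw [norm_sub_rev]; exact h c hc
        · exact hs.2 c hc d hd hcd
    have := le_csSup hbd (⟨_, hsep, rfl⟩ : (insert ((2 : ℝ) • x) s).card ∈ S)
    rw [Finset.card_insert_of_notMem hmem] at this
    omega

/-- Successive approximation: the residual at scale `2⁻ʲ`, blown up to the unit ball, is
approximated by the half-net. -/
theorem exists_dyadic_net (E : Type*) [NormedAddCommGroup E] [NormedSpace ℝ E]
    [FiniteDimensional ℝ E] (j : ℕ) :
    ∃ N : Finset E, N.card ≤ (5 ^ Module.finrank ℝ E) ^ j ∧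
      ∀ x : E, ‖x‖ ≤ 1 → ∃ p ∈ N, ‖x - p‖ ≤ (1 / 2) ^ j := by
  classical
  induction j with
  | zero => exact ⟨{0}, by simp, fun x hx => ⟨0, by simp, by simpa using hx⟩⟩
  | succ j ih =>
    obtain ⟨N, hN, hcov⟩ := ih
    obtain ⟨N', hN', hcov'⟩ := exists_half_net E
    refine ⟨Finset.image₂ (fun p q => p + ((1 / 2 : ℝ) ^ j) • q) N N', ?_, fun x hx => ?_⟩
    · rw [pow_succ]
      exact (Finset.card_image₂_le _ _ _).trans (Nat.mul_le_mul hN hN')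
    · obtain ⟨p, hp, hxp⟩ := hcov x hx
      obtain ⟨q, hq, hpq⟩ := hcov' ((2 : ℝ) ^ j • (x - p)) (by
        rw [norm_smul, norm_pow, Real.norm_of_nonneg zero_le_two]
        calc (2 : ℝ) ^ j * ‖x - p‖ ≤ 2 ^ j * (1 / 2) ^ j := by gcongr
          _ = 1 := by rw [← mul_pow]; norm_num)
      refine ⟨_, Finset.mem_image₂_of_mem hp hq, ?_⟩
      have : x - (p + (1 / 2 : ℝ) ^ j • q) = (1 / 2 : ℝ) ^ j • ((2 : ℝ) ^ j • (x - p) - q) := by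
        rw [smul_sub, smul_smul, ← mul_pow]; norm_num; abel
      rw [this, norm_smul, norm_pow, Real.norm_of_nonneg (by norm_num : (0 : ℝ) ≤ 1 / 2), pow_succ]
      gcongr

/-- A linear map that almost preserves the norm on a fine net almost preserves it everywhere. -/
theorem norm_sq_bounds_of_net {E F : Type*} [NormedAddCommGroup E] [NormedSpace ℝ E]
    [SeminormedAddCommGroup F] [NormedSpace ℝ F]
    (M : E →L[ℝ] F) (N : Finset E)
    (hcov : ∀ x : E, ‖x‖ ≤ 1 → ∃ p ∈ N, ‖x - p‖ ≤ 1 / 64)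
    (hN : ∀ p ∈ N, 63 / 64 * ‖p‖ ^ 2 ≤ ‖M p‖ ^ 2 ∧ ‖M p‖ ^ 2 ≤ 65 / 64 * ‖p‖ ^ 2) (x : E) :
    9 / 10 * ‖x‖ ^ 2 ≤ ‖M x‖ ^ 2 ∧ ‖M x‖ ^ 2 ≤ 11 / 10 * ‖x‖ ^ 2 := by
  have hup : ∀ p ∈ N, ‖M p‖ ≤ 65 / 64 * ‖p‖ := fun p hp =>
    abs_le_of_sq_le_sq' (by nlinarith [(hN p hp).2, sq_nonneg ‖p‖]) (by positivity) |>.2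
  have hlo : ∀ p ∈ N, 63 / 64 * ‖p‖ ≤ ‖M p‖ := fun p hp =>
    abs_le_of_sq_le_sq' (by nlinarith [(hN p hp).1, sq_nonneg ‖p‖]) (by positivity) |>.2
  have key : ∀ y : E, ‖y‖ = 1 →
      ‖M y‖ ≤ 65 / 64 * (65 / 64) + ‖M‖ * (1 / 64) ∧
      63 / 64 * (63 / 64) - ‖M‖ * (1 / 64) ≤ ‖M y‖ := by
    intro y hy
    obtain ⟨p, hp, hyp⟩ := hcov y hy.le
    have h1 : ‖M y‖ ≤ ‖M p‖ + ‖M (y - p)‖ := by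
      have := norm_add_le (M p) (M (y - p))
      rwa [← map_add, add_sub_cancel] at this
    have h2 : ‖M p‖ - ‖M (y - p)‖ ≤ ‖M y‖ := by
      have := norm_sub_le (M y) (M (y - p))
      rw [← map_sub, sub_sub_cancel] at this
      linarith
    have h3 : ‖M (y - p)‖ ≤ ‖M‖ * (1 / 64) :=
      (M.le_opNorm _).trans (mul_le_mul_of_nonneg_left hyp (norm_nonneg _))
    have h4 : ‖p‖ ≤ 65 / 64 := by
      have := norm_sub_le y (y - p)
      rw [sub_sub_cancel] at this
      linarith
    have h5 : 63 / 64 ≤ ‖p‖ := by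
      have := norm_add_le p (y - p)
      rw [add_sub_cancel] at this
      linarith
    constructor
    · linarith [hup p hp]
    · linarith [hlo p hp]
  -- A self-bounding inequality: `‖M‖` is finite, so its small multiple on the right can be
  -- absorbed.
  have hM : ‖M‖ ≤ 65 / 64 * (65 / 64) + ‖M‖ * (1 / 64) :=
    M.opNorm_le_of_unit_norm (by positivity) fun y hy => (key y hy).1
  rcases eq_or_ne x 0 with rfl | hx
  · simp
  have hx0 : 0 < ‖x‖ := norm_pos_iff.2 hx
  obtain ⟨h1, h2⟩ := key (‖x‖⁻¹ • x) (by rw [norm_smul]; simp [hx0.ne'])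
  rw [map_smul, norm_smul, norm_inv, norm_norm] at h1 h2
  have e1 : ‖M x‖ = ‖x‖ * (‖x‖⁻¹ * ‖M x‖) := by field_simp
  set u := ‖x‖⁻¹ * ‖M x‖ with hu
  have hu0 : 0 ≤ u := by positivity
  have hulo : 9 / 10 ≤ u ^ 2 := by nlinarith
  have huhi : u ^ 2 ≤ 11 / 10 := by nlinarith
  rw [e1, mul_pow]
  constructor <;> nlinarith [sq_nonneg ‖x‖]

end Nets

/-! ### Block restricted isometry implies recovery -/

section Recovery

variable {ι : Type*} [DecidableEq ι]

/-- Exchange argument: in a maximiser, replacing an element by an outside one cannot increase the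
sum. -/
theorem exists_max_sum_subset (f : ι → ℝ) (U : Finset ι) {s : ℕ} (hs : s ≤ U.card) :
    ∃ T ⊆ U, T.card = s ∧ (∀ S ⊆ U, S.card = s → ∑ i ∈ S, f i ≤ ∑ i ∈ T, f i) ∧
      ∀ i ∈ T, ∀ j ∈ U \ T, f j ≤ f i := by
  obtain ⟨T, hT, hmax⟩ := Finset.exists_max_image (Finset.powersetCard s U)
    (fun S => ∑ i ∈ S, f i) (Finset.powersetCard_nonempty.2 hs)
  rw [Finset.mem_powersetCard] at hT
  have hmax' : ∀ S ⊆ U, S.card = s → ∑ i ∈ S, f i ≤ ∑ i ∈ T, f i := fun S h1 h2 =>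
    hmax S (Finset.mem_powersetCard.2 ⟨h1, h2⟩)
  refine ⟨T, hT.1, hT.2, hmax', fun i hi j hj => ?_⟩
  rw [Finset.mem_sdiff] at hj
  have hj' : j ∉ T.erase i := fun h => hj.2 (Finset.mem_of_mem_erase h)
  have := hmax' (insert j (T.erase i))
    (Finset.insert_subset hj.1 ((Finset.erase_subset _ _).trans hT.1))
    (by rw [Finset.card_insert_of_notMem hj', Finset.card_erase_add_one hi, hT.2])
  rw [Finset.sum_insert hj', ← Finset.add_sum_erase T f hi] at this
  linarith

/-- A subadditive set function that is dominated by a multiple of the `ℓ₂` norm on sets of size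
at most `s` is dominated on all sets by the `ℓ_∞` and `ℓ₁` norms. -/
theorem le_of_subadditive_of_le_sqrt {f : ι → ℝ} (hf : ∀ i, 0 ≤ f i) {φ : Finset ι → ℝ} {C : ℝ}
    (hC : 0 ≤ C) {s : ℕ} (hs : 0 < s)
    (hadd : ∀ U V, Disjoint U V → φ (U ∪ V) ≤ φ U + φ V) {W : Finset ι}
    (hφ : ∀ U ⊆ W, U.card ≤ s → φ U ≤ C * √(∑ i ∈ U, f i ^ 2)) (U : Finset ι) (hU : U ⊆ W)
    {a : ℝ} (ha : 0 ≤ a) (hfa : ∀ i ∈ U, f i ≤ a) :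
    φ U ≤ C * (√s * a + (∑ i ∈ U, f i) / √s) := by
  induction hk : U.card using Nat.strong_induction_on generalizing U a with
  | _ k ih =>
    have hs' : (0 : ℝ) < √s := Real.sqrt_pos.2 (by exact_mod_cast hs)
    have hsmall : ∀ V ⊆ U, V.card ≤ s → φ V ≤ C * (√s * a) := by
      intro V hVU hV
      refine (hφ V (hVU.trans hU) hV).trans (mul_le_mul_of_nonneg_left ?_ hC)
      rw [Real.sqrt_le_left (by positivity), mul_pow, Real.sq_sqrt (by positivity)]
      calc ∑ i ∈ V, f i ^ 2 ≤ ∑ i ∈ V, a ^ 2 :=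
            Finset.sum_le_sum fun i hi => pow_le_pow_left₀ (hf i) (hfa i (hVU hi)) 2
        _ = V.card * a ^ 2 := by simp
        _ ≤ s * a ^ 2 := by gcongr
    rcases le_or_gt U.card s with hle | hlt
    · refine (hsmall U subset_rfl hle).trans (mul_le_mul_of_nonneg_left ?_ hC)
      have : 0 ≤ (∑ i ∈ U, f i) / √s := div_nonneg (Finset.sum_nonneg fun i _ => hf i) hs'.le
      linarith
    · obtain ⟨T, hTU, hTs, -, htop⟩ := exists_max_sum_subset f U hlt.le
      have hb : ∀ j ∈ U \ T, f j ≤ (∑ i ∈ T, f i) / s := by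
        intro j hj
        rw [le_div_iff₀ (by exact_mod_cast hs), mul_comm, ← nsmul_eq_mul, ← hTs]
        exact Finset.card_nsmul_le_sum _ _ _ fun i hi => htop i hi j hj
      have hcard : (U \ T).card < k := by
        rw [Finset.card_sdiff_of_subset hTU]; omega
      have h1 := ih _ hcard (U \ T) (Finset.sdiff_subset.trans hU)
        (div_nonneg (Finset.sum_nonneg fun i _ => hf i) (by positivity)) hb rfl
      have h2 := hadd T (U \ T) Finset.disjoint_sdiff
      rw [Finset.union_sdiff_of_subset hTU] at h2
      have h3 := hsmall T hTU hTs.le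
      have h4 : √s * ((∑ i ∈ T, f i) / s) = (∑ i ∈ T, f i) / √s := by
        field_simp
        rw [Real.sq_sqrt (by positivity), mul_comm]
      rw [h4] at h1
      rw [← Finset.sum_sdiff hTU]
      calc φ U ≤ C * (√s * a) + C * ((∑ i ∈ T, f i) / √s + (∑ i ∈ U \ T, f i) / √s) := by linarith
        _ = _ := by ring

variable [Fintype ι] {E H : Type*} [NormedAddCommGroup E] [NormedSpace ℝ E]
  [NormedAddCommGroup H] [InnerProductSpace ℝ H]

/-- The linear map `M` has restricted isometry constant at most `δ` on vectors with at most `s`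
nonzero blocks. -/
def BlockRIP (M : (ι → E) →ₗ[ℝ] H) (s : ℕ) (δ : ℝ) : Prop :=
  ∀ (S : Finset ι) (v : ι → E), S.card ≤ s → (∀ i ∉ S, v i = 0) →
    (1 - δ) * ∑ i, ‖v i‖ ^ 2 ≤ ‖M v‖ ^ 2 ∧ ‖M v‖ ^ 2 ≤ (1 + δ) * ∑ i, ‖v i‖ ^ 2

/-- Polarisation: comparing `a u + v` with `a u - v` gives a quadratic in `a` that is nonnegative
everywhere. Its discriminant yields the bound with no need to normalise `u` and `v`. -/
theorem BlockRIP.inner_le {M : (ι → E) →ₗ[ℝ] H} {s : ℕ} {δ : ℝ} (hδ : 0 ≤ δ)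
    (hM : BlockRIP M s δ) {S T : Finset ι} (hST : Disjoint S T) (hcard : S.card + T.card ≤ s)
    {u v : ι → E} (hu : ∀ i ∉ S, u i = 0) (hv : ∀ i ∉ T, v i = 0) :
    |inner ℝ (M u) (M v)| ≤ δ * √(∑ i, ‖u i‖ ^ 2) * √(∑ i, ‖v i‖ ^ 2) := by
  set U := ∑ i, ‖u i‖ ^ 2 with hUdef
  set V := ∑ i, ‖v i‖ ^ 2 with hVdef
  have hU : 0 ≤ U := by positivity
  have hV : 0 ≤ V := by positivity
  have hdisj : ∀ i, u i = 0 ∨ v i = 0 := fun i => by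
    by_cases h : i ∈ S
    · exact Or.inr (hv i (Finset.disjoint_left.1 hST h))
    · exact Or.inl (hu i h)
  have hc : (S ∪ T).card ≤ s := (Finset.card_union_le _ _).trans hcard
  have key : ∀ a : ℝ, 0 ≤ δ * U * (a * a) + -(2 * inner ℝ (M u) (M v)) * a + δ * V := by
    intro a
    have hs1 : ∑ i, ‖(a • u + v) i‖ ^ 2 = a ^ 2 * U + V := by
      rw [hUdef, hVdef, Finset.mul_sum, ← Finset.sum_add_distrib]
      refine Finset.sum_congr rfl fun i _ => ?_
      rcases hdisj i with h | h <;> simp [h, norm_smul, mul_pow]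
    have hs2 : ∑ i, ‖(a • u - v) i‖ ^ 2 = a ^ 2 * U + V := by
      rw [hUdef, hVdef, Finset.mul_sum, ← Finset.sum_add_distrib]
      refine Finset.sum_congr rfl fun i _ => ?_
      rcases hdisj i with h | h <;> simp [h, norm_smul, mul_pow]
    have hz1 : ∀ i ∉ S ∪ T, (a • u + v) i = 0 := fun i hi => by
      rw [Finset.notMem_union] at hi; simp [hu i hi.1, hv i hi.2]
    have hz2 : ∀ i ∉ S ∪ T, (a • u - v) i = 0 := fun i hi => by
      rw [Finset.notMem_union] at hi; simp [hu i hi.1, hv i hi.2]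
    have h1 := (hM _ _ hc hz1).2
    have h2 := (hM _ _ hc hz2).1
    rw [hs1, map_add, map_smul, norm_add_sq_real, real_inner_smul_left] at h1
    rw [hs2, map_sub, map_smul, norm_sub_sq_real, real_inner_smul_left] at h2
    nlinarith
  have hd := discrim_le_zero key
  rw [discrim] at hd
  rw [mul_assoc, ← Real.sqrt_mul hU]
  refine abs_le_of_sq_le_sq ?_ (by positivity)
  rw [mul_pow, Real.sq_sqrt (by positivity)]
  nlinarith

/-- The null space property for blocks. -/
theorem BlockRIP.two_mul_sum_lt {M : (ι → E) →ₗ[ℝ] H} {s : ℕ} {δ : ℝ} (hδ : 0 ≤ δ)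
    (hδ3 : δ < 1 / 3) (hs : 0 < s) (hι : s ≤ Fintype.card ι) (hM : BlockRIP M (2 * s) δ)
    {v : ι → E} (hv : M v = 0) (hv0 : v ≠ 0) {S : Finset ι} (hS : S.card ≤ s) :
    2 * ∑ i ∈ S, ‖v i‖ < ∑ i, ‖v i‖ := by
  obtain ⟨T, -, hTs, hTmax, htop⟩ := exists_max_sum_subset (fun i => ‖v i‖) Finset.univ
    (s := s) (by simpa using hι)
  obtain ⟨S', hSS', -, hS'⟩ := Finset.exists_subsuperset_card_eq (Finset.subset_univ S) hS
    (by simpa using hι)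
  have hle : ∑ i ∈ S, ‖v i‖ ≤ ∑ i ∈ T, ‖v i‖ :=
    (Finset.sum_le_sum_of_subset_of_nonneg hSS' fun _ _ _ => norm_nonneg _).trans
      (hTmax S' (Finset.subset_univ _) hS')
  let r : Finset ι → ι → E := fun U i => if i ∈ U then v i else 0
  have hr0 : ∀ U : Finset ι, ∀ i ∉ U, r U i = 0 := fun U i hi => by simp [r, hi]
  have hrsum : ∀ U : Finset ι, ∑ i, ‖r U i‖ ^ 2 = ∑ i ∈ U, ‖v i‖ ^ 2 := fun U => by
    rw [← Finset.sum_subset (Finset.subset_univ U) fun i _ hi => by simp [r, hi]]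
    exact Finset.sum_congr rfl fun i hi => by simp [r, hi]
  have hradd : ∀ U V : Finset ι, Disjoint U V → r (U ∪ V) = r U + r V := fun U V hUV => by
    ext i
    by_cases hi : i ∈ U
    · simp [r, hi, Finset.disjoint_left.1 hUV hi]
    · simp [r, hi]
  set n2 := √(∑ i ∈ T, ‖v i‖ ^ 2) with hn2
  have hs' : (0 : ℝ) < √s := Real.sqrt_pos.2 (by exact_mod_cast hs)
  -- Since `M v = 0`, the energy of the top part equals, up to sign, its inner product with the
  -- image of the tail. Shelling the tail bounds this by `δ * n2 * (∑ i, ‖v i‖) / √s`.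
  have hpeel := le_of_subadditive_of_le_sqrt (f := fun i => ‖v i‖) (fun i => norm_nonneg _)
    (φ := fun U => |inner ℝ (M (r T)) (M (r U))|) (C := δ * n2) (by positivity) hs
    (fun U V hUV => by
      simp only [hradd U V hUV, map_add, inner_add_right]; exact abs_add_le _ _)
    (W := Tᶜ) (fun U hU hUs => by
      have := hM.inner_le hδ (S := T) (T := U)
        (Finset.disjoint_left.2 fun i hi hi' => Finset.mem_compl.1 (hU hi') hi)
        (by omega) (hr0 T) (hr0 U)
      rwa [hrsum, hrsum] at this)
    Tᶜ subset_rfl (a := (∑ i ∈ T, ‖v i‖) / s)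
    (by positivity) (fun j hj => by
      rw [le_div_iff₀ (by exact_mod_cast hs), mul_comm, ← nsmul_eq_mul, ← hTs]
      refine Finset.card_nsmul_le_sum _ _ _ fun i hi => htop i hi j ?_
      simpa using hj)
  have h4 : √s * ((∑ i ∈ T, ‖v i‖) / s) = (∑ i ∈ T, ‖v i‖) / √s := by
    field_simp
    rw [Real.sq_sqrt (by positivity), mul_comm]
  rw [h4, ← add_div, Finset.sum_add_sum_compl] at hpeel
  have hsplit : M (r Tᶜ) = -M (r T) := by
    have : r T + r Tᶜ = v := by
      ext i; by_cases hi : i ∈ T <;> simp [r, hi]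
    rw [eq_neg_iff_add_eq_zero, add_comm, ← map_add, this, hv]
  simp only [hsplit, inner_neg_right, abs_neg, real_inner_self_eq_norm_sq] at hpeel
  rw [abs_of_nonneg (sq_nonneg ‖M (r T)‖)] at hpeel
  have hlow := (hM T (r T) (by omega) (hr0 T)).1
  rw [hrsum, ← Real.sq_sqrt (Finset.sum_nonneg fun i _ => sq_nonneg _ :
    0 ≤ ∑ i ∈ T, ‖v i‖ ^ 2), ← hn2] at hlow
  have hn20 : 0 ≤ n2 := Real.sqrt_nonneg _
  have hpos : 0 < ∑ i, ‖v i‖ := by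
    obtain ⟨i, hi⟩ := Function.ne_iff.1 hv0
    exact Finset.sum_pos' (fun _ _ => norm_nonneg _) ⟨i, Finset.mem_univ _, norm_pos_iff.2 hi⟩
  have h5 : (1 - δ) * (√s * n2) ≤ δ * ∑ i, ‖v i‖ := by
    rcases hn20.eq_or_lt with h0 | h0
    · rw [← h0]; simp; positivity
    · have h6 : (1 - δ) * n2 ≤ δ * ((∑ i, ‖v i‖) / √s) := by
        refine le_of_mul_le_mul_right ?_ h0
        calc (1 - δ) * n2 * n2 = (1 - δ) * n2 ^ 2 := by ring
          _ ≤ _ := hlow.trans hpeel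
          _ = _ := by ring
      calc (1 - δ) * (√s * n2) = √s * ((1 - δ) * n2) := by ring
        _ ≤ √s * (δ * ((∑ i, ‖v i‖) / √s)) := by gcongr
        _ = _ := by field_simp
  have h7 : ∑ i ∈ T, ‖v i‖ ≤ √s * n2 := by
    refine abs_le_of_sq_le_sq' ?_ (by positivity) |>.2
    rw [mul_pow, hn2, Real.sq_sqrt (by positivity), Real.sq_sqrt (by positivity), ← hTs]
    exact sq_sum_le_card_mul_sum_sq
  have h8 : (1 - δ) * ∑ i ∈ T, ‖v i‖ ≤ (1 - δ) * (√s * n2) :=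
    mul_le_mul_of_nonneg_left h7 (by linarith)
  -- Here `δ < 1 / 3` enters, as `δ / (1 - δ) < 1 / 2`.
  nlinarith

/-- The null space property of `z - x`: the mass gained off `S` exceeds what can be lost on `S`. -/
theorem BlockRIP.sum_norm_lt {M : (ι → E) →ₗ[ℝ] H} {s : ℕ} {δ : ℝ} (hδ : 0 ≤ δ)
    (hδ3 : δ < 1 / 3) (hs : 0 < s) (hι : s ≤ Fintype.card ι) (hM : BlockRIP M (2 * s) δ)
    {x z : ι → E} {S : Finset ι} (hS : S.card ≤ s) (hx : ∀ i ∉ S, x i = 0)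
    (hzx : M z = M x) (hne : z ≠ x) : ∑ i, ‖x i‖ < ∑ i, ‖z i‖ := by
  have h := hM.two_mul_sum_lt hδ hδ3 hs hι (v := z - x) (by rw [map_sub, hzx, sub_self])
    (sub_ne_zero.2 hne) hS
  rw [← Finset.sum_add_sum_compl S] at h ⊢
  rw [← Finset.sum_add_sum_compl S (fun i => ‖z i‖)]
  have h1 : ∑ i ∈ Sᶜ, ‖x i‖ = 0 :=
    Finset.sum_eq_zero fun i hi => by simp [hx i (Finset.mem_compl.1 hi)]
  have h2 : ∑ i ∈ Sᶜ, ‖(z - x) i‖ = ∑ i ∈ Sᶜ, ‖z i‖ :=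
    Finset.sum_congr rfl fun i hi => by simp [hx i (Finset.mem_compl.1 hi)]
  have h3 : ∑ i ∈ S, ‖x i‖ ≤ ∑ i ∈ S, ‖z i‖ + ∑ i ∈ S, ‖(z - x) i‖ := by
    rw [← Finset.sum_add_distrib]
    refine Finset.sum_le_sum fun i _ => ?_
    have := norm_sub_le (z i) (z i - x i)
    rwa [sub_sub_cancel] at this
  linarith

end Recovery

/-! ### From isometry of the row blocks to the JOBS program -/

section Deterministic

variable {K L m n : ℕ}

/-- On `s`-sparse vectors, the rows of `A` in `T` preserve the squared norm up to the factor `g`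
and a relative error of one tenth. -/
def RowsRIP (A : Matrix (Fin m) (Fin n) ℝ) (T : Finset (Fin m)) (s : ℕ) (g : ℝ) : Prop :=
  ∀ (S : Finset (Fin n)) (x : Fin n → ℝ), S.card ≤ s → (∀ i ∉ S, x i = 0) →
    9 / 10 * (g * ∑ i, x i ^ 2) ≤ ∑ r ∈ T, (A *ᵥ x) r ^ 2 ∧
      ∑ r ∈ T, (A *ᵥ x) r ^ 2 ≤ 11 / 10 * (g * ∑ i, x i ^ 2)

theorem sum_jobsMatrix_mulVec_sq (A : Matrix (Fin m) (Fin n) ℝ) (I : Fin K → Fin L → Fin m)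
    (w : (Σ _ : Fin K, Fin n) → ℝ) :
    ∑ r, (jobsMatrix A I *ᵥ w) r ^ 2 =
      ∑ j, ∑ r ∈ Finset.univ.image (I j), (A *ᵥ fun i => w ⟨j, i⟩) r ^ 2 := by
  rw [Fintype.sum_sigma]
  refine Finset.sum_congr rfl fun j _ => ?_
  rw [← Finset.sum_coe_sort (Finset.univ.image (I j))
    (fun r => (A *ᵥ fun i => w ⟨j, i⟩) r ^ 2)]
  refine Finset.sum_congr rfl fun r _ => ?_
  congr 1
  simp only [Matrix.mulVec, dotProduct, Fintype.sum_sigma]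
  rw [Finset.sum_eq_single j]
  · simp [jobsMatrix, distinctRows, Matrix.blockDiagonal'_apply_eq]
  · intro j' _ hj'
    simp [jobsMatrix, Matrix.blockDiagonal'_apply_ne _ _ _ hj'.symm]
  · simp

theorem sum_jobsMatrix_col_sq (A : Matrix (Fin m) (Fin n) ℝ) (I : Fin K → Fin L → Fin m)
    (j : Fin K) (i : Fin n) :
    ∑ r, jobsMatrix A I r ⟨j, i⟩ ^ 2 = ∑ r ∈ Finset.univ.image (I j), A r i ^ 2 := by
  have h := sum_jobsMatrix_mulVec_sq A I (Pi.single ⟨j, i⟩ 1)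
  simp only [Matrix.mulVec_single_one, Matrix.col_apply] at h
  rw [h, Finset.sum_eq_single j]
  · refine Finset.sum_congr rfl fun r _ => ?_
    have : (fun i' => (Pi.single ⟨j, i⟩ 1 : (Σ _ : Fin K, Fin n) → ℝ) ⟨j, i'⟩) =
        Pi.single i 1 := by
      ext i'; by_cases hi : i' = i <;> simp [hi]
    rw [this]; simp
  · intro j' _ hj'
    have : (fun i' => (Pi.single ⟨j, i⟩ 1 : (Σ _ : Fin K, Fin n) → ℝ) ⟨j', i'⟩) = 0 := by
      ext i'; simp [hj']
    rw [this]; simp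
  · simp

theorem RowsRIP.col_sq {A : Matrix (Fin m) (Fin n) ℝ} {T : Finset (Fin m)} {s : ℕ} {g : ℝ}
    (h : RowsRIP A T s g) (hs : 0 < s) (i : Fin n) :
    9 / 10 * g ≤ ∑ r ∈ T, A r i ^ 2 ∧ ∑ r ∈ T, A r i ^ 2 ≤ 11 / 10 * g := by
  have := h {i} (Pi.single i 1) (by rw [Finset.card_singleton]; exact hs) fun i' hi' => by
    simp at hi'; simp [hi']
  have h1 : ∑ i', (Pi.single i (1 : ℝ) : Fin n → ℝ) i' ^ 2 = 1 := by
    simp [Pi.single_apply]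
  simpa [h1] using this

theorem exists_finset_of_encard_le {ι : Type*} [Finite ι] {V : Set ι} {s : ℕ} (h : V.encard ≤ s) :
    ∃ S : Finset ι, S.card ≤ s ∧ ↑S = V := by
  have hV : V.Finite := V.toFinite
  refine ⟨hV.toFinset, ?_, hV.coe_toFinset⟩
  rwa [hV.encard_eq_coe_toFinset_card, Nat.cast_le] at h

/-- Unit vectors are sparse, so the squared column norms in block `j` lie within a tenth of `g j`.
Normalising thus costs factors `10/11` and `10/9`, and `11/10 * 10/9 = 1 + 2/9`. -/
theorem jobsRIPConst_le_of_rowsRIP {A : Matrix (Fin m) (Fin n) ℝ} {I : Fin K → Fin L → Fin m}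
    {s : ℕ} (hs : 0 < s) {g : Fin K → ℝ} (hg : ∀ j, 0 < g j)
    (h : ∀ j, RowsRIP A (Finset.univ.image (I j)) s (g j)) :
    jobsRIPConst s A I ≤ 2 / 9 := by
  refine csInf_le ⟨0, fun δ hδ => hδ.1⟩ ⟨by norm_num, fun v hv => ?_⟩
  obtain ⟨S, hS, hSv⟩ := exists_finset_of_encard_le hv
  have hv0 : ∀ j, ∀ i ∉ S, v ⟨j, i⟩ = 0 := fun j i hi => by
    by_contra hne
    exact hi (Finset.mem_coe.1 (hSv ▸ ⟨⟨j, i⟩, hne, rfl⟩))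
  let c : Fin K → Fin n → ℝ := fun j i => ∑ r ∈ Finset.univ.image (I j), A r i ^ 2
  have hc : ∀ j i, 9 / 10 * g j ≤ c j i ∧ c j i ≤ 11 / 10 * g j := fun j i => (h j).col_sq hs i
  have hmul : colNormalize (jobsMatrix A I) *ᵥ v =
      jobsMatrix A I *ᵥ fun p => (√(c p.1 p.2))⁻¹ * v p := by
    rw [colNormalize, ← Matrix.mulVec_mulVec]
    congr 1
    ext ⟨j, i⟩
    rw [Matrix.mulVec_diagonal, sum_jobsMatrix_col_sq]
  rw [hmul, sum_jobsMatrix_mulVec_sq, Fintype.sum_sigma, Finset.mul_sum, Finset.mul_sum]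
  have key : ∀ j, (1 - 2 / 9) * ∑ i, v ⟨j, i⟩ ^ 2 ≤ ∑ r ∈ Finset.univ.image (I j),
        (A *ᵥ fun i => (√(c j i))⁻¹ * v ⟨j, i⟩) r ^ 2 ∧
      ∑ r ∈ Finset.univ.image (I j), (A *ᵥ fun i => (√(c j i))⁻¹ * v ⟨j, i⟩) r ^ 2 ≤
        (1 + 2 / 9) * ∑ i, v ⟨j, i⟩ ^ 2 := by
    intro j
    have hj := h j S (fun i => (√(c j i))⁻¹ * v ⟨j, i⟩) hS fun i hi => by rw [hv0 j i hi, mul_zero]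
    have hgj := hg j
    have hterm : ∀ i, g j * ((√(c j i))⁻¹ * v ⟨j, i⟩) ^ 2 = g j / c j i * v ⟨j, i⟩ ^ 2 := fun i => by
      have : 0 ≤ c j i := Finset.sum_nonneg fun _ _ => sq_nonneg _
      rw [mul_pow, inv_pow, Real.sq_sqrt this]; ring
    have hcpos : ∀ i, 0 < c j i := fun i => by linarith [(hc j i).1]
    have hlo : 10 / 11 * ∑ i, v ⟨j, i⟩ ^ 2 ≤ g j * ∑ i, ((√(c j i))⁻¹ * v ⟨j, i⟩) ^ 2 := by
      rw [Finset.mul_sum, Finset.mul_sum]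
      refine Finset.sum_le_sum fun i _ => ?_
      rw [hterm]
      refine mul_le_mul_of_nonneg_right ?_ (sq_nonneg _)
      rw [le_div_iff₀ (hcpos i)]
      linarith [(hc j i).2]
    have hhi : g j * ∑ i, ((√(c j i))⁻¹ * v ⟨j, i⟩) ^ 2 ≤ 10 / 9 * ∑ i, v ⟨j, i⟩ ^ 2 := by
      rw [Finset.mul_sum, Finset.mul_sum]
      refine Finset.sum_le_sum fun i _ => ?_
      rw [hterm]
      refine mul_le_mul_of_nonneg_right ?_ (sq_nonneg _)
      rw [div_le_iff₀ (hcpos i)]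
      linarith [(hc j i).1]
    have hsum : 0 ≤ ∑ i, v ⟨j, i⟩ ^ 2 := Finset.sum_nonneg fun _ _ => sq_nonneg _
    constructor <;> linarith [hj.1, hj.2]
  exact ⟨Finset.sum_le_sum fun j _ => (key j).1, Finset.sum_le_sum fun j _ => (key j).2⟩

/-- The block diagonal measurement map, the block of index `j` being divided by `√(g j)`. -/
def scaledJobsMap (A : Matrix (Fin m) (Fin n) ℝ) (I : Fin K → Fin L → Fin m) (g : Fin K → ℝ) :
    (Fin n → EuclideanSpace ℝ (Fin K)) →ₗ[ℝ]
      EuclideanSpace ℝ (Σ j : Fin K, (Finset.univ.image (I j) : Finset (Fin m))) where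
  toFun v := WithLp.toLp 2 fun r => (√(g r.1))⁻¹ * (A *ᵥ fun i => v i r.1) r.2
  map_add' u v := by
    ext r
    have : (A *ᵥ fun i => (u + v) i r.1) = (A *ᵥ fun i => u i r.1) + A *ᵥ fun i => v i r.1 := by
      rw [← Matrix.mulVec_add]; rfl
    exact (congrArg ((√(g r.1))⁻¹ * ·) (congrFun this r.2)).trans (mul_add _ _ _)
  map_smul' a v := by
    ext r
    have : (A *ᵥ fun i => (a • v) i r.1) = a • (A *ᵥ fun i => v i r.1) := by
      rw [← Matrix.mulVec_smul]; rfl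
    exact (congrArg ((√(g r.1))⁻¹ * ·) (congrFun this r.2)).trans (mul_left_comm _ _ _)

theorem scaledJobsMap_apply (A : Matrix (Fin m) (Fin n) ℝ) (I : Fin K → Fin L → Fin m)
    (g : Fin K → ℝ) (v : Fin n → EuclideanSpace ℝ (Fin K))
    (r : Σ j : Fin K, (Finset.univ.image (I j) : Finset (Fin m))) :
    scaledJobsMap A I g v r = (√(g r.1))⁻¹ * (A *ᵥ fun i => v i r.1) r.2 := rfl

theorem norm_sq_scaledJobsMap (A : Matrix (Fin m) (Fin n) ℝ) (I : Fin K → Fin L → Fin m)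
    {g : Fin K → ℝ} (hg : ∀ j, 0 < g j) (v : Fin n → EuclideanSpace ℝ (Fin K)) :
    ‖scaledJobsMap A I g v‖ ^ 2 =
      ∑ j, (g j)⁻¹ * ∑ r ∈ Finset.univ.image (I j), (A *ᵥ fun i => v i j) r ^ 2 := by
  rw [EuclideanSpace.norm_sq_eq, Fintype.sum_sigma]
  refine Finset.sum_congr rfl fun j _ => ?_
  rw [← Finset.sum_coe_sort (Finset.univ.image (I j)) (fun r => (A *ᵥ fun i => v i j) r ^ 2),
    Finset.mul_sum]
  refine Finset.sum_congr rfl fun r _ => ?_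
  rw [scaledJobsMap_apply, Real.norm_eq_abs, sq_abs, mul_pow, inv_pow, Real.sq_sqrt (hg j).le]

/-- All columns of a row-sparse unknown share one support, so the isometry bounds of the separate
blocks add up once each is scaled to gain one. -/
theorem blockRIP_scaledJobsMap {A : Matrix (Fin m) (Fin n) ℝ} {I : Fin K → Fin L → Fin m}
    {s : ℕ} {g : Fin K → ℝ} (hg : ∀ j, 0 < g j)
    (h : ∀ j, RowsRIP A (Finset.univ.image (I j)) s (g j)) :
    BlockRIP (scaledJobsMap A I g) s (1 / 10) := by
  intro S v hS hv
  have hsum : ∑ i, ‖v i‖ ^ 2 = ∑ j, ∑ i, v i j ^ 2 := by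
    rw [Finset.sum_comm]
    exact Finset.sum_congr rfl fun i _ => by simp [EuclideanSpace.norm_sq_eq]
  rw [norm_sq_scaledJobsMap A I hg, hsum, Finset.mul_sum, Finset.mul_sum]
  constructor <;> refine Finset.sum_le_sum fun j _ => ?_
  · rw [← div_eq_inv_mul, le_div_iff₀ (hg j)]
    have := (h j S (fun i => v i j) hS fun i hi => by simp [hv i hi]).1
    linarith
  · rw [← div_eq_inv_mul, div_le_iff₀ (hg j)]
    have := (h j S (fun i => v i j) hS fun i hi => by simp [hv i hi]).2
    linarith

/-- The rows of a matrix of unknowns as vectors of a Euclidean space. -/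
def rowVectors (X : Matrix (Fin n) (Fin K) ℝ) : Fin n → EuclideanSpace ℝ (Fin K) :=
  fun i => WithLp.toLp 2 (X i)

theorem sum_norm_rowVectors (X : Matrix (Fin n) (Fin K) ℝ) :
    ∑ i, ‖rowVectors X i‖ = normOneTwo X :=
  Finset.sum_congr rfl fun i _ => by simp [rowVectors, EuclideanSpace.norm_eq]

/-- Links the constraints with multiplicities to the map on distinct rows: repeated equations add
nothing. -/
theorem scaledJobsMap_eq_of_mem_jobsFeasible {A : Matrix (Fin m) (Fin n) ℝ}
    {I : Fin K → Fin L → Fin m} {y : Fin m → ℝ} {X Z : Matrix (Fin n) (Fin K) ℝ}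
    (hX : X ∈ jobsFeasible A I y) (hZ : Z ∈ jobsFeasible A I y) (g : Fin K → ℝ) :
    scaledJobsMap A I g (rowVectors X) = scaledJobsMap A I g (rowVectors Z) := by
  ext ⟨j, r, hr⟩
  obtain ⟨l, -, rfl⟩ := Finset.mem_image.1 hr
  rw [scaledJobsMap_apply, scaledJobsMap_apply]
  congr 1
  exact (congrFun (hX j) l).trans (congrFun (hZ j) l).symm

theorem jobsRecovers_of_rowsRIP {A : Matrix (Fin m) (Fin n) ℝ} {I : Fin K → Fin L → Fin m}
    {s : ℕ} (hs : 0 < s) (hsn : s ≤ n) (hK : 0 < K) {g : Fin K → ℝ} (hg : ∀ j, 0 < g j)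
    (h : ∀ j, RowsRIP A (Finset.univ.image (I j)) (2 * s) (g j)) :
    JobsRecovers s A I := by
  intro x hx
  obtain ⟨S, hS, hSx⟩ := exists_finset_of_encard_le hx
  have hx0 : ∀ i ∉ S, x i = 0 := fun i hi => by
    by_contra hne
    exact hi (Finset.mem_coe.1 (hSx ▸ hne))
  set X₀ : Matrix (Fin n) (Fin K) ℝ := Matrix.of fun i _ => x i with hX₀
  have hfeas : X₀ ∈ jobsFeasible A I (A *ᵥ x) := fun j => by
    ext l; rfl
  have hlt : ∀ Z ∈ jobsFeasible A I (A *ᵥ x), Z ≠ X₀ → normOneTwo X₀ < normOneTwo Z := by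
    intro Z hZ hne
    rw [← sum_norm_rowVectors, ← sum_norm_rowVectors]
    refine (blockRIP_scaledJobsMap hg h).sum_norm_lt (by norm_num) (by norm_num) hs
      (by simpa using hsn) hS (fun i hi => ?_) (scaledJobsMap_eq_of_mem_jobsFeasible hZ hfeas g)
      fun heq => hne ?_
    · ext j; simp [rowVectors, hX₀, hx0 i hi]
    · ext i j
      exact congrArg (fun v : EuclideanSpace ℝ (Fin K) => v j) (congrFun heq i)
  have hmin : ∀ X, IsJobsMinimizer A I (A *ᵥ x) X → X = X₀ := by
    intro X hX
    by_contra hne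
    exact (hlt X hX.1 hne).not_ge (hX.2 hfeas)
  refine fun X => ⟨⟨hmin X, ?_⟩, fun hX => ?_⟩
  · rintro rfl
    refine ⟨hfeas, fun Z hZ => ?_⟩
    rcases eq_or_ne Z X₀ with rfl | hne
    · exact le_refl (normOneTwo _)
    · exact (hlt Z hZ hne).le
  · rw [hmin X hX]
    ext i
    have : (K : ℝ) ≠ 0 := by positivity
    simp [jobsEstimate, hX₀, this]

end Deterministic

/-! ### A net for sparse vectors -/

section Net

variable {m n : ℕ}

/-- Extension of a vector by zero outside `S`. -/
def extendZero (S : Finset (Fin n)) : EuclideanSpace ℝ S →ₗ[ℝ] (Fin n → ℝ) where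
  toFun y i := if h : i ∈ S then y ⟨i, h⟩ else 0
  map_add' y z := by ext i; by_cases h : i ∈ S <;> simp [h]
  map_smul' a y := by ext i; by_cases h : i ∈ S <;> simp [h]

theorem extendZero_apply (S : Finset (Fin n)) (y : EuclideanSpace ℝ S) (i : Fin n) :
    extendZero S y i = if h : i ∈ S then y ⟨i, h⟩ else 0 := rfl

theorem sum_extendZero_sq (S : Finset (Fin n)) (y : EuclideanSpace ℝ S) :
    ∑ i, extendZero S y i ^ 2 = ‖y‖ ^ 2 := by
  rw [EuclideanSpace.norm_sq_eq, ← Finset.sum_subset (Finset.subset_univ S) fun i _ hi => by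
    simp [extendZero_apply, hi], ← Finset.sum_coe_sort]
  exact Finset.sum_congr rfl fun i _ => by simp [extendZero_apply]

theorem exists_extendZero_eq {S : Finset (Fin n)} {x : Fin n → ℝ} (hx : ∀ i ∉ S, x i = 0) :
    ∃ y, extendZero S y = x := by
  refine ⟨WithLp.toLp 2 fun i => x i, ?_⟩
  ext i
  by_cases h : i ∈ S
  · simp [extendZero_apply, h]
  · simp [extendZero_apply, h, hx i h]

/-- The rows of `A` in `T`, divided by `√g`, as a map on the vectors supported on `S`. -/
def restrictedRowsMap (A : Matrix (Fin m) (Fin n) ℝ) (T : Finset (Fin m)) (S : Finset (Fin n))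
    (g : ℝ) : EuclideanSpace ℝ S →ₗ[ℝ] EuclideanSpace ℝ T where
  toFun y := WithLp.toLp 2 fun r => (√g)⁻¹ * (A *ᵥ extendZero S y) r
  map_add' y z := by
    ext r
    simp only [map_add, Matrix.mulVec_add, PiLp.add_apply, Pi.add_apply, mul_add]
  map_smul' a y := by
    ext r
    simp only [map_smul, Matrix.mulVec_smul, PiLp.smul_apply, Pi.smul_apply, smul_eq_mul,
      RingHom.id_apply]
    ring

theorem norm_sq_restrictedRowsMap (A : Matrix (Fin m) (Fin n) ℝ) (T : Finset (Fin m))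
    (S : Finset (Fin n)) {g : ℝ} (hg : 0 < g) (y : EuclideanSpace ℝ S) :
    ‖restrictedRowsMap A T S g y‖ ^ 2 = (∑ r ∈ T, (A *ᵥ extendZero S y) r ^ 2) / g := by
  rw [EuclideanSpace.norm_sq_eq, ← Finset.sum_coe_sort T, Finset.sum_div]
  refine Finset.sum_congr rfl fun r _ => ?_
  have : restrictedRowsMap A T S g y r = (√g)⁻¹ * (A *ᵥ extendZero S y) r := rfl
  rw [this, Real.norm_eq_abs, sq_abs, mul_pow, inv_pow, Real.sq_sqrt hg.le, div_eq_inv_mul]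

/-- The rows of `A` in `T` preserve the squared norm of `x` up to the factor `g` and a relative
error of `1 / 64`. -/
def RowsNear (A : Matrix (Fin m) (Fin n) ℝ) (T : Finset (Fin m)) (g : ℝ) (x : Fin n → ℝ) : Prop :=
  63 / 64 * (g * ∑ i, x i ^ 2) ≤ ∑ r ∈ T, (A *ᵥ x) r ^ 2 ∧
    ∑ r ∈ T, (A *ᵥ x) r ^ 2 ≤ 65 / 64 * (g * ∑ i, x i ^ 2)

/-- The net depends on neither `A`, `T` nor `g`, so it is deterministic and serves all blocks.
Supports of size exactly `k` suffice because smaller ones can be enlarged; six halvings give the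
mesh `1 / 64`. -/
theorem exists_net_rowsRIP {k : ℕ} (hk : k ≤ n) :
    ∃ F : Finset (Fin n → ℝ), F.card ≤ n.choose k * (5 ^ k) ^ 6 ∧
      ∀ (m : ℕ) (A : Matrix (Fin m) (Fin n) ℝ) (T : Finset (Fin m)) (g : ℝ), 0 < g →
        (∀ x ∈ F, RowsNear A T g x) → RowsRIP A T k g := by
  classical
  choose N hNcard hNcov using fun S : Finset (Fin n) =>
    exists_dyadic_net (EuclideanSpace ℝ S) 6
  refine ⟨(Finset.powersetCard k Finset.univ).biUnion fun S => (N S).image (extendZero S),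
    ?_, fun m A T g hg hF S' x hS' hx => ?_⟩
  · refine (Finset.card_biUnion_le_card_mul _ _ ((5 ^ k) ^ 6) fun S hS => ?_).trans_eq ?_
    · refine Finset.card_image_le.trans ((hNcard S).trans_eq ?_)
      rw [finrank_euclideanSpace, Fintype.card_coe, (Finset.mem_powersetCard.1 hS).2]
    · rw [Finset.card_powersetCard, Finset.card_univ, Fintype.card_fin]
  · obtain ⟨S, hSS', -, hS⟩ := Finset.exists_subsuperset_card_eq (Finset.subset_univ S') hS'
      (by simpa using hk)
    obtain ⟨y, rfl⟩ := exists_extendZero_eq (S := S) fun i hi => hx i fun h => hi (hSS' h)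
    have h := norm_sq_bounds_of_net (LinearMap.toContinuousLinearMap (restrictedRowsMap A T S g))
      (N S) (by norm_num at hNcov ⊢; exact hNcov S) (fun p hp => by
        have hp' := hF (extendZero S p) (Finset.mem_biUnion.2
          ⟨S, Finset.mem_powersetCard.2 ⟨Finset.subset_univ _, hS⟩, Finset.mem_image_of_mem _ hp⟩)
        rw [RowsNear, sum_extendZero_sq] at hp'
        rw [LinearMap.coe_toContinuousLinearMap', norm_sq_restrictedRowsMap A T S hg,
          le_div_iff₀ hg, div_le_iff₀ hg]
        constructor <;> linarith [hp'.1, hp'.2]) y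
    rw [LinearMap.coe_toContinuousLinearMap', norm_sq_restrictedRowsMap A T S hg,
      le_div_iff₀ hg, div_le_iff₀ hg] at h
    rw [sum_extendZero_sq]
    constructor <;> linarith [h.1, h.2]

end Net

/-! ### Independence and the estimate for one block and one vector -/

section Probability

variable {Ω : Type*} [MeasurableSpace Ω] {P : Measure Ω}

/-- Currying identifies a product law over pairs with a product of product laws. It gives
independence of the rows of `A` and of the bootstrap samples. -/
theorem _root_.ProbabilityTheory.iIndepFun.curry {ι κ E : Type*} [Countable ι] [Countable κ]
    [MeasurableSpace E] {X : ι → κ → Ω → E} (hX : ∀ i k, AEMeasurable (X i k) P)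
    (h : iIndepFun (fun p : ι × κ => X p.1 p.2) P) : iIndepFun (fun i ω k => X i k ω) P := by
  have := h.isProbabilityMeasure
  have hp : ∀ i k, IsProbabilityMeasure (P.map (X i k)) :=
    fun i k => Measure.isProbabilityMeasure_map (hX i k)
  have hrow : ∀ i, P.map (fun ω k => X i k ω) = Measure.infinitePi fun k => P.map (X i k) :=
    fun i => iIndepFun.map_fun_eq_infinitePi_map₀' (hX i)
      (h.precomp (g := Prod.mk i) (Prod.mk_right_injective i))
  rw [iIndepFun_iff_map_fun_eq_infinitePi_map₀' fun i => aemeasurable_pi_iff.2 (hX i)]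
  simp_rw [hrow]
  rw [← Measure.infinitePi_map_curry, ← iIndepFun.map_fun_eq_infinitePi_map₀'
    (fun p : ι × κ => hX p.1 p.2) h, AEMeasurable.map_map_of_aemeasurable
    (MeasurableEquiv.measurable _).aemeasurable
    (aemeasurable_pi_iff.2 fun p : ι × κ => hX p.1 p.2)]
  rfl

variable [IsProbabilityMeasure P]

/-- Variances and sub-Gaussian parameters of independent summands add in the same way, so the
scale-invariant ratio `κ` is kept. -/
theorem subgaussian_linear_combination {ι : Type*} [Fintype ι] {X : ι → Ω → ℝ} {ν : Measure ℝ}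
    {κ : ℝ≥0} (hν : IsSubgaussianLaw κ ν) (hX : ∀ i, HasLaw (X i) ν P) (hind : iIndepFun X P)
    {x : ι → ℝ} (hx : Var[id; ν] * ∑ i, x i ^ 2 = 1) :
    HasSubgaussianMGF (fun ω => ∑ i, X i ω * x i) κ P ∧
      ∫ ω, (∑ i, X i ω * x i) ^ 2 ∂P = 1 := by
  have hsub : ∀ i, HasSubgaussianMGF (X i) (κ * Var[id; ν].toNNReal) P := fun i =>
    HasSubgaussianMGF.of_map (X := id) (hX i).aemeasurable ((hX i).map_eq ▸ hν.2)
  have hsub' : ∀ i, HasSubgaussianMGF (fun ω => X i ω * x i)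
      ((x i ^ 2).toNNReal * (κ * Var[id; ν].toNNReal)) P := fun i => by
    rw [Real.toNNReal_of_nonneg (sq_nonneg (x i))]
    have h := (hsub i).const_mul (x i)
    simp only [mul_comm (x i)] at h
    exact h
  have hind' : iIndepFun (fun i ω => X i ω * x i) P :=
    hind.comp (fun i y => y * x i) fun i => by fun_prop
  have hsum := HasSubgaussianMGF.sum_of_iIndepFun hind' (s := Finset.univ) fun i _ => hsub' i
  have hc : ∑ i, (x i ^ 2).toNNReal * (κ * Var[id; ν].toNNReal) = κ := by
    apply NNReal.coe_injective
    push_cast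
    simp_rw [Real.coe_toNNReal _ hν.1.le, Real.coe_toNNReal _ (sq_nonneg _)]
    rw [← Finset.sum_mul]
    calc (∑ i, x i ^ 2) * (κ * Var[id; ν]) = κ * (Var[id; ν] * ∑ i, x i ^ 2) := by ring
      _ = κ := by rw [hx, mul_one]
  rw [hc] at hsum
  refine ⟨hsum, ?_⟩
  rw [← variance_of_integral_eq_zero hsum.aemeasurable hsum.integral_eq_zero]
  have hvar := IndepFun.variance_sum (μ := P) (X := fun i ω => X i ω * x i) (s := Finset.univ)
    (fun i _ => (hsub' i).memLp 2) fun i _ j _ hij => hind'.indepFun hij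
  have hfun : (∑ i, fun ω => X i ω * x i) = fun ω => ∑ i, X i ω * x i := by ext ω; simp
  rw [hfun] at hvar
  rw [hvar]
  have hv : ∀ i, Var[X i; P] = Var[id; ν] := fun i => (hX i).variance_eq
  simp_rw [variance_mul_const, hv]
  rw [← Finset.mul_sum, hx]

variable {m n : ℕ}

theorem measure_not_rowsNear_le {ν : Measure ℝ} {κ : ℝ≥0} (hκ : 0 < κ)
    (hν : IsSubgaussianLaw κ ν) {A : Ω → Matrix (Fin m) (Fin n) ℝ}
    (hA : ∀ i k, HasLaw (fun ω => A ω i k) ν P)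
    (hind : iIndepFun (fun (p : Fin m × Fin n) ω => A ω p.1 p.2) P) (T : Finset (Fin m))
    (x : Fin n → ℝ) :
    P.real {ω | ¬ RowsNear (A ω) T (T.card * Var[id; ν]) x} ≤
      2 * Real.exp (-(concentrationRate κ (1 / 64) * T.card)) := by
  rcases eq_or_ne x 0 with rfl | hx
  · simp [RowsNear]
    positivity
  have hq : 0 < Var[id; ν] * ∑ i, x i ^ 2 := by
    obtain ⟨i, hi⟩ := Function.ne_iff.1 hx
    exact mul_pos hν.1 (Finset.sum_pos' (fun _ _ => sq_nonneg _)
      ⟨i, Finset.mem_univ _, pow_pos (abs_pos.2 hi) 2 |>.trans_eq (sq_abs _)⟩)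
  set q := Var[id; ν] * ∑ i, x i ^ 2 with hqdef
  -- Rescaled so that each row product has second moment one.
  let z : Fin n → ℝ := fun k => (√q)⁻¹ * x k
  have hz : Var[id; ν] * ∑ k, z k ^ 2 = 1 := by
    simp only [z, mul_pow, inv_pow, Real.sq_sqrt hq.le, ← Finset.mul_sum]
    rw [mul_left_comm, ← hqdef, inv_mul_cancel₀ hq.ne']
  have hrow : ∀ i, iIndepFun (fun k ω => A ω i k) P := fun i =>
    hind.precomp (g := Prod.mk i) (Prod.mk_right_injective i)
  have hX := fun i => subgaussian_linear_combination hν (hA i) (hrow i) hz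
  have hXind : iIndepFun (fun i ω => ∑ k, A ω i k * z k) P :=
    (iIndepFun.curry (X := fun i k ω => A ω i k) (fun i k => (hA i k).aemeasurable) hind).comp
      (fun _ a => ∑ k, a k * z k) fun _ => by fun_prop
  have hsq : ∀ ω i, (A ω *ᵥ x) i ^ 2 = q * (∑ k, A ω i k * z k) ^ 2 := fun ω i => by
    have h1 : ∑ k, A ω i k * z k = (√q)⁻¹ * (A ω *ᵥ x) i := by
      simp only [Matrix.mulVec, dotProduct, Finset.mul_sum, z]
      exact Finset.sum_congr rfl fun k _ => by ring
    rw [h1, mul_pow, inv_pow, Real.sq_sqrt hq.le, mul_inv_cancel_left₀ hq.ne']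
  have hup := measure_sum_sq_ge_le hκ (fun i => (hX i).1) (fun i => (hX i).2) hXind T
    (t := 1 / 64) (by norm_num)
  have hlo := measure_sum_sq_le_le hκ (fun i => (hX i).1) (fun i => (hX i).2) hXind T
    (t := 1 / 64) (by norm_num)
  refine (measureReal_mono (s₂ := {ω | ∑ i ∈ T, (∑ k, A ω i k * z k) ^ 2 ≤ (1 - 1 / 64) * T.card} ∪
    {ω | (1 + 1 / 64) * T.card ≤ ∑ i ∈ T, (∑ k, A ω i k * z k) ^ 2}) fun ω hω => ?_).trans
    ((measureReal_union_le _ _).trans (by linarith))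
  by_contra hcon
  simp only [Set.mem_union, Set.mem_ofPred_eq, not_or, not_le] at hcon hω
  apply hω
  have e : (T.card : ℝ) * Var[id; ν] * ∑ i, x i ^ 2 = q * T.card := by rw [hqdef]; ring
  rw [RowsNear, e]
  simp_rw [hsq, ← Finset.mul_sum]
  constructor
  · have := mul_le_mul_of_nonneg_left hcon.1.le hq.le
    linarith
  · have := mul_le_mul_of_nonneg_left hcon.2.le hq.le
    linarith

theorem measurableSet_rowsNear (T : Finset (Fin m)) (g : ℝ) (x : Fin n → ℝ) :
    MeasurableSet {a : Fin m → Fin n → ℝ | RowsNear a T g x} := by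
  have : Measurable fun a : Fin m → Fin n → ℝ => ∑ r ∈ T, (Matrix.mulVec a x r) ^ 2 := by
    simp only [Matrix.mulVec, dotProduct]
    fun_prop
  exact (measurableSet_le measurable_const this).inter (measurableSet_le this measurable_const)

/-- If `Y` takes finitely many values and is independent of `X`, then a lower bound for the
probability of events that depend on `X` holds conditionally on `Y`. -/
theorem _root_.ProbabilityTheory.IndepFun.mul_measureReal_le {β γ : Type*} [MeasurableSpace β]
    [MeasurableSpace γ] [Finite γ] [MeasurableSingletonClass γ] {X : Ω → β} {Y : Ω → γ}
    (h : IndepFun X Y P) (hX : AEMeasurable X P) (hY : AEMeasurable Y P) {G : γ → Set β}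
    (hG : ∀ c, MeasurableSet (G c)) (Q : Set γ) {p : ℝ}
    (hp : ∀ c ∈ Q, p ≤ P.real (X ⁻¹' G c)) :
    p * P.real (Y ⁻¹' Q) ≤ P.real {ω | Y ω ∈ Q ∧ X ω ∈ G (Y ω)} := by
  have hQ : Q.Finite := Q.toFinite
  have hnull : ∀ c, NullMeasurableSet (Y ⁻¹' {c}) P := fun c =>
    hY.nullMeasurable (measurableSet_singleton c)
  have hdisj : Pairwise (Function.onFun Disjoint fun c => Y ⁻¹' ({c} : Set γ)) :=
    fun c c' hcc' => Disjoint.preimage _ (by simpa using hcc')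
  -- Partition by the value of `Y`; on each piece `G` is a fixed set and independence factorises the
  -- probability.
  have e1 : Y ⁻¹' Q = ⋃ c ∈ hQ.toFinset, Y ⁻¹' {c} := by ext; simp
  have e2 : {ω | Y ω ∈ Q ∧ X ω ∈ G (Y ω)} =
      ⋃ c ∈ hQ.toFinset, X ⁻¹' G c ∩ Y ⁻¹' {c} := by ext; simp; tauto
  rw [e1, e2, measureReal_biUnion_finset₀ (fun c _ c' _ hcc' => (hdisj hcc').aedisjoint)
      (fun c _ => hnull c),
    measureReal_biUnion_finset₀ (fun c _ c' _ hcc' =>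
      ((hdisj hcc').mono Set.inter_subset_right Set.inter_subset_right).aedisjoint)
      (fun c _ => (hX.nullMeasurable (hG c)).inter (hnull c)), Finset.mul_sum]
  refine Finset.sum_le_sum fun c hc => ?_
  have : P.real (X ⁻¹' G c ∩ Y ⁻¹' {c}) = P.real (X ⁻¹' G c) * P.real (Y ⁻¹' {c}) := by
    rw [measureReal_def, h.measure_inter_preimage_eq_mul _ _ (hG c) (measurableSet_singleton c),
      ENNReal.toReal_mul]
    rfl
  rw [this]
  exact mul_le_mul_of_nonneg_right (hp c (hQ.mem_toFinset.1 hc)) measureReal_nonneg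

end Probability

/-! ### Entropy of the net and choice of the constant -/

theorem choose_le_exp {n k : ℕ} (hk : 0 < k) (hkn : k ≤ n) :
    (n.choose k : ℝ) ≤ Real.exp (k * (1 + Real.log (n / k))) := by
  have hk' : (0 : ℝ) < k := by exact_mod_cast hk
  have hn' : (0 : ℝ) < n := by exact_mod_cast hk.trans_le hkn
  have h1 : (n.choose k : ℝ) ≤ n ^ k / k.factorial := Nat.choose_le_pow_div k n
  have h2 : (k : ℝ) ^ k / k.factorial ≤ Real.exp k := Real.pow_div_factorial_le_exp _ hk'.le k
  have h3 : Real.exp (k * (1 + Real.log (n / k))) = Real.exp k * (n / k) ^ k := by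
    rw [mul_add, mul_one, Real.exp_add, Real.exp_nat_mul, Real.exp_log (by positivity)]
  rw [h3]
  calc (n.choose k : ℝ) ≤ n ^ k / k.factorial := h1
    _ = (k : ℝ) ^ k / k.factorial * (n / k) ^ k := by rw [div_pow]; field_simp
    _ ≤ _ := by gcongr

/-- The entropy constant of the nets of sparse vectors. -/
def netConst : ℝ := 1 + 6 * Real.log 5 + Real.log 2

theorem netConst_pos : 0 < netConst := by
  have h5 : 0 < Real.log 5 := Real.log_pos (by norm_num)
  have h2 : 0 < Real.log 2 := Real.log_pos (by norm_num)
  unfold netConst; positivity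

theorem two_mul_choose_mul_le_exp {n k : ℕ} (hk : 0 < k) (hkn : k ≤ n) :
    2 * (n.choose k * (5 ^ k) ^ 6 : ℝ) ≤ Real.exp (k * (netConst + Real.log (n / k))) := by
  have hk' : (1 : ℝ) ≤ k := by exact_mod_cast hk
  have h5 : ((5 : ℝ) ^ k) ^ 6 = Real.exp (k * (6 * Real.log 5)) := by
    rw [Real.exp_nat_mul, ← pow_mul, mul_comm k 6, pow_mul]
    congr 1
    rw [show (6 : ℝ) = (6 : ℕ) by norm_num, Real.exp_nat_mul, Real.exp_log (by norm_num)]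
  have h2 : (2 : ℝ) ≤ Real.exp (k * Real.log 2) := by
    have : Real.exp (Real.log 2) ≤ Real.exp (k * Real.log 2) :=
      Real.exp_le_exp.2 (le_mul_of_one_le_left (Real.log_nonneg (by norm_num)) hk')
    rwa [Real.exp_log (by norm_num)] at this
  calc 2 * (n.choose k * (5 ^ k) ^ 6 : ℝ)
      ≤ Real.exp (k * Real.log 2) *
        (Real.exp (k * (1 + Real.log (n / k))) * Real.exp (k * (6 * Real.log 5))) := by
        rw [h5]; gcongr; exact choose_le_exp hk hkn
    _ = _ := by rw [← Real.exp_add, ← Real.exp_add]; congr 1; unfold netConst; ring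

/-- The constant of the sample complexity bound. -/
def sampleConst (κ ρ : ℝ) : ℝ :=
  (1 + netConst / Real.log ρ) / concentrationRate κ (1 / 64)

theorem sampleConst_pos {κ ρ : ℝ} (hκ : 0 < κ) (hρ : 1 < ρ) : 0 < sampleConst κ ρ :=
  div_pos (add_pos one_pos (div_pos netConst_pos (Real.log_pos hρ)))
    (concentrationRate_pos hκ (by norm_num))

/-- The ratio `ρ` keeps `log (n / k)` at least `log ρ > 0`, so the entropy term `k * netConst` is
absorbed into a multiple of `k * log (n / k)`. -/
theorem union_bound_le {κ ρ D N : ℝ} (hκ : 0 < κ) (hρ : 1 < ρ) {n k K : ℕ} (hk : 0 < k)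
    (hkn : ρ * k ≤ n) (hK : 0 < K) (hD : 0 < D) (hD1 : D ≤ 1)
    (h : sampleConst κ ρ * (k * Real.log (n / k) + Real.log K + Real.log D⁻¹) ≤ N) :
    K * ((n.choose k * (5 ^ k) ^ 6) *
      (2 * Real.exp (-(concentrationRate κ (1 / 64) * N)))) ≤ D := by
  set c := concentrationRate κ (1 / 64) with hc
  have hcpos : 0 < c := concentrationRate_pos hκ (by norm_num)
  have hk' : (0 : ℝ) < k := by exact_mod_cast hk
  have hK' : (0 : ℝ) < K := by exact_mod_cast hK
  have hlr := Real.log_pos hρ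
  have hlog : Real.log ρ ≤ Real.log (n / k) :=
    Real.log_le_log (by linarith) ((le_div_iff₀ hk').2 hkn)
  have hkn' : k ≤ n := by
    have : (k : ℝ) ≤ n := by nlinarith
    exact_mod_cast this
  have hlK : 0 ≤ Real.log K := Real.log_nonneg (by exact_mod_cast hK)
  have hlD : 0 ≤ Real.log D⁻¹ := Real.log_nonneg ((one_le_inv₀ hD).2 hD1)
  have hr : 0 < netConst / Real.log ρ := div_pos netConst_pos hlr
  have h1 : (1 + netConst / Real.log ρ) *
      (k * Real.log (n / k) + Real.log K + Real.log D⁻¹) ≤ c * N := by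
    have := mul_le_mul_of_nonneg_left h hcpos.le
    rwa [sampleConst, ← mul_assoc, ← hc, mul_div_cancel₀ _ hcpos.ne'] at this
  have h2 : k * netConst ≤ netConst / Real.log ρ * (k * Real.log (n / k)) := by
    rw [div_mul_eq_mul_div, le_div_iff₀ hlr]
    calc k * netConst * Real.log ρ ≤ k * netConst * Real.log (n / k) :=
          mul_le_mul_of_nonneg_left hlog (mul_nonneg hk'.le netConst_pos.le)
      _ = _ := by ring
  have h3 : k * (netConst + Real.log (n / k)) + Real.log K + Real.log D⁻¹ ≤ c * N := by
    have : 0 ≤ netConst / Real.log ρ * (Real.log K + Real.log D⁻¹) := by positivity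
    nlinarith
  calc K * ((n.choose k * (5 ^ k) ^ 6) * (2 * Real.exp (-(c * N))))
      = K * (2 * (n.choose k * (5 ^ k) ^ 6 : ℝ)) * Real.exp (-(c * N)) := by ring
    _ ≤ K * Real.exp (k * (netConst + Real.log (n / k))) * Real.exp (-(c * N)) := by
        gcongr; exact two_mul_choose_mul_le_exp hk hkn'
    _ = Real.exp (Real.log K + k * (netConst + Real.log (n / k)) - c * N) := by
        rw [sub_eq_add_neg, Real.exp_add, Real.exp_add, Real.exp_log hK']
    _ ≤ Real.exp (-Real.log D⁻¹) := Real.exp_le_exp.2 (by linarith)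
    _ = D := by rw [Real.log_inv, neg_neg, Real.exp_log hD]

/-! ### All blocks simultaneously, and the bootstrap samples -/

section Probability

variable {Ω : Type*} [MeasurableSpace Ω] {P : Measure Ω} {m n L K : ℕ}

/-- For fixed bootstrap samples with at least `d` distinct elements, all blocks are well conditioned
on a finite set of vectors with high probability. -/
theorem le_measure_forall_rowsNear [IsProbabilityMeasure P] {ν : Measure ℝ} {κ : ℝ≥0} (hκ : 0 < κ)
    (hν : IsSubgaussianLaw κ ν) {A : Ω → Matrix (Fin m) (Fin n) ℝ}
    (hA : ∀ i k, HasLaw (fun ω => A ω i k) ν P)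
    (hind : iIndepFun (fun (p : Fin m × Fin n) ω => A ω p.1 p.2) P) (F : Finset (Fin n → ℝ))
    {T : Fin K → Finset (Fin m)} {d : ℕ} (hT : ∀ j, d ≤ (T j).card) :
    1 - K * (F.card * (2 * Real.exp (-(concentrationRate κ (1 / 64) * d)))) ≤
      P.real {ω | ∀ j, ∀ x ∈ F, RowsNear (A ω) (T j) ((T j).card * Var[id; ν]) x} := by
  set G := {ω | ∀ j, ∀ x ∈ F, RowsNear (A ω) (T j) ((T j).card * Var[id; ν]) x} with hG
  set p := 2 * Real.exp (-(concentrationRate κ (1 / 64) * d)) with hp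
  have hbad : ∀ j x, P.real {ω | ¬ RowsNear (A ω) (T j) ((T j).card * Var[id; ν]) x} ≤ p := by
    intro j x
    refine (measure_not_rowsNear_le hκ hν hA hind (T j) x).trans ?_
    have hc := concentrationRate_pos (κ := κ) (t := 1 / 64) hκ (by norm_num)
    have : (d : ℝ) ≤ (T j).card := by exact_mod_cast hT j
    rw [hp]
    gcongr
  have hsub : Gᶜ ⊆ ⋃ j ∈ (Finset.univ : Finset (Fin K)), ⋃ x ∈ F,
      {ω | ¬ RowsNear (A ω) (T j) ((T j).card * Var[id; ν]) x} := by
    intro ω hω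
    simp only [hG, Set.mem_compl_iff, Set.mem_ofPred_eq, not_forall] at hω
    obtain ⟨j, x, hx, h⟩ := hω
    simp only [Set.mem_iUnion]
    exact ⟨j, Finset.mem_univ j, x, hx, h⟩
  have hle : P.real Gᶜ ≤ K * (F.card * p) := by
    refine (measureReal_mono hsub (measure_ne_top P _)).trans ((measureReal_biUnion_finset_le _ _).trans ?_)
    calc _ ≤ ∑ _j : Fin K, (F.card : ℝ) * p := by
          refine Finset.sum_le_sum fun j _ => (measureReal_biUnion_finset_le _ _).trans ?_
          exact (Finset.sum_le_card_nsmul _ _ _ fun x _ => hbad j x).trans_eq (nsmul_eq_mul _ _)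
      _ = _ := by simp
  have h1 : (1 : ℝ) ≤ P.real G + P.real Gᶜ := by
    rw [← probReal_univ (μ := P), ← Set.union_compl_self G]
    exact measureReal_union_le _ _
  linarith

theorem pow_le_measure_forall_numDistinct {I : Ω → Fin K → Fin L → Fin m}
    (hI : ∀ j l, AEMeasurable (fun ω => I ω j l) P)
    (hind : iIndepFun (fun (p : Fin K × Fin L) ω => I ω p.1 p.2) P) {d : ℕ} {a : ℝ} (ha : 0 ≤ a)
    (hd : ∀ j, a ≤ P.real {ω | d ≤ numDistinct (I ω j)}) :
    a ^ K ≤ P.real {ω | ∀ j, d ≤ numDistinct (I ω j)} := by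
  have hI' : iIndepFun (fun j ω l => I ω j l) P :=
    iIndepFun.curry (X := fun j l ω => I ω j l) hI hind
  have h := hI'.meas_iInter (s := fun j => {ω | d ≤ numDistinct (I ω j)}) fun j =>
    ⟨{f | d ≤ numDistinct f}, Set.Finite.measurableSet (Set.toFinite _), rfl⟩
  have e : {ω | ∀ j, d ≤ numDistinct (I ω j)} = ⋂ j, {ω | d ≤ numDistinct (I ω j)} := by
    ext; simp
  rw [e, measureReal_def, h, ENNReal.toReal_prod]
  calc a ^ K = ∏ _j : Fin K, a := by simp
    _ ≤ _ := Finset.prod_le_prod (fun _ _ => ha) fun j _ => hd j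

end Probability

end Jobs

end

/-! ### The sample complexity theorem -/

theorem mainTheorem7 (κ : ℝ≥0) (ρ : ℝ) (hρ : 1 < ρ) :
    ∃ β : ℝ, 0 < β ∧
      ∀ (Ω : Type*) [MeasurableSpace Ω] (P : Measure Ω) [IsProbabilityMeasure P]
        (m n L K s d : ℕ) (α μ : ℝ) (ν : Measure ℝ)
        (A : Ω → Matrix (Fin m) (Fin n) ℝ) (I : Ω → Fin K → Fin L → Fin m),
        0 < s → ρ * (2 * s) ≤ n → 0 < K →
        0 ≤ α → α < 1 → 0 < μ → μ < 1 → 1 - μ < (1 - α) ^ K →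
        -- the entries of `A` are i.i.d. with sub-Gaussian law `ν`
        Jobs.IsSubgaussianLaw κ ν →
        (∀ i k, HasLaw (fun ω => A ω i k) ν P) →
        iIndepFun (fun (p : Fin m × Fin n) ω => A ω p.1 p.2) P →
        -- the bootstrap indices are i.i.d. uniform, and independent of `A`
        (∀ j l, HasLaw (fun ω => I ω j l) (uniformOn (Set.univ : Set (Fin m))) P) →
        iIndepFun (fun (p : Fin K × Fin L) ω => I ω p.1 p.2) P →
        IndepFun (fun ω i k => A ω i k) I P →
        (∀ j, 1 - α ≤ P.real {ω | d ≤ Jobs.numDistinct (I ω j)}) →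
        β * (2 * s * Real.log (n / (2 * s)) + Real.log K +
          Real.log ((1 - α) ^ K / ((1 - α) ^ K - (1 - μ)))) ≤ d →
        1 - μ ≤ P.real {ω | Jobs.jobsRIPConst (2 * s) (A ω) (I ω) < √2 - 1 ∧
          Jobs.JobsRecovers s (A ω) (I ω)} := by
  -- The concentration bounds need a positive parameter, so `κ` is weakened to `κ + 1`, which also
  -- covers `κ = 0`.
  have hκ' : (0 : ℝ) < (κ + 1 : ℝ≥0) := by positivity
  refine ⟨Jobs.sampleConst (κ + 1 : ℝ≥0) ρ, Jobs.sampleConst_pos hκ' hρ, ?_⟩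
  intro Ω _ P _ m n L K s d α μ ν A I hs hn hK hα0 hα1 hμ0 hμ1 hαμ hν hA hAind hI hIind hAI hV hd
  have hν' : Jobs.IsSubgaussianLaw (κ + 1) ν := by
    refine ⟨hν.1, hν.2.integrable_exp_mul, fun t => (hν.2.mgf_le t).trans ?_⟩
    have : (κ * Var[id; ν].toNNReal : ℝ≥0) ≤ (κ + 1) * Var[id; ν].toNNReal := by
      gcongr; exact le_self_add
    gcongr
  have hpow : 0 < (1 - α) ^ K := pow_pos (by linarith) K
  set D := ((1 - α) ^ K - (1 - μ)) / (1 - α) ^ K with hDdef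
  have hD : 0 < D := div_pos (by linarith) hpow
  have hD1 : D ≤ 1 := (div_le_one hpow).2 (by linarith)
  have hn' : ρ * ((2 * s : ℕ) : ℝ) ≤ n := by push_cast; exact hn
  have hsn : 2 * s ≤ n := by
    have h1 : (0 : ℝ) < ((2 * s : ℕ) : ℝ) := by exact_mod_cast (by omega : 0 < 2 * s)
    have : ((2 * s : ℕ) : ℝ) ≤ n := by nlinarith
    exact_mod_cast this
  have hd' : Jobs.sampleConst (κ + 1 : ℝ≥0) ρ * ((2 * s : ℕ) * Real.log (n / (2 * s : ℕ)) +
      Real.log K + Real.log D⁻¹) ≤ d := by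
    rw [hDdef, inv_div]; push_cast at hd ⊢; exact hd
  -- Needed for nonempty blocks, hence positive scales `g j`.
  have hdpos : 0 < d := by
    have h1 : (0 : ℝ) < ((2 * s : ℕ) : ℝ) := by exact_mod_cast (by omega : 0 < 2 * s)
    have h2 : 0 < Real.log (n / (2 * s : ℕ)) :=
      Real.log_pos (hρ.trans_le ((le_div_iff₀ h1).2 hn'))
    have h3 : 0 ≤ Real.log K := Real.log_nonneg (by exact_mod_cast hK)
    have h4 : 0 ≤ Real.log D⁻¹ := Real.log_nonneg ((one_le_inv₀ hD).2 hD1)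
    have h5 : (0 : ℝ) < d := lt_of_lt_of_le (mul_pos (Jobs.sampleConst_pos hκ' hρ)
      (by have := mul_pos h1 h2; linarith)) hd'
    exact_mod_cast h5
  obtain ⟨F, hFcard, hF⟩ := Jobs.exists_net_rowsRIP hsn
  have hbound : K * (F.card * (2 * Real.exp (-(concentrationRate (κ + 1 : ℝ≥0) (1 / 64) * d))))
      ≤ D := by
    refine le_trans ?_ (Jobs.union_bound_le hκ' hρ (by omega : 0 < 2 * s) hn' hK hD hD1 hd')
    have : (F.card : ℝ) ≤ n.choose (2 * s) * (5 ^ (2 * s)) ^ 6 := by exact_mod_cast hFcard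
    gcongr
  let T : (Fin K → Fin L → Fin m) → Fin K → Finset (Fin m) := fun ι j => Finset.univ.image (ι j)
  let G : (Fin K → Fin L → Fin m) → Set (Fin m → Fin n → ℝ) := fun ι =>
    {a | ∀ j, ∀ x ∈ F, Jobs.RowsNear a (T ι j) ((T ι j).card * Var[id; ν]) x}
  have hG : ∀ ι, MeasurableSet (G ι) := fun ι => by
    have : G ι = ⋂ j, ⋂ x ∈ F,
        {a : Fin m → Fin n → ℝ | Jobs.RowsNear a (T ι j) ((T ι j).card * Var[id; ν]) x} := by
      ext a
      simp only [Set.mem_iInter]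
      exact Iff.rfl
    rw [this]
    exact MeasurableSet.iInter fun j => Finset.measurableSet_biInter _ fun x _ =>
      Jobs.measurableSet_rowsNear _ _ x
  have hIm : AEMeasurable I P :=
    aemeasurable_pi_iff.2 fun j => aemeasurable_pi_iff.2 fun l => (hI j l).aemeasurable
  have hAm : AEMeasurable (fun ω i k => A ω i k) P :=
    aemeasurable_pi_iff.2 fun i => aemeasurable_pi_iff.2 fun k => (hA i k).aemeasurable
  have hmain := hAI.mul_measureReal_le hAm hIm hG {ι | ∀ j, d ≤ Jobs.numDistinct (ι j)}
    (p := 1 - D) fun ι hι => by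
      have := Jobs.le_measure_forall_rowsNear (κ := κ + 1) hκ' hν' hA hAind F (T := T ι) hι
      exact (by linarith : 1 - D ≤ _).trans this
  have hdist := Jobs.pow_le_measure_forall_numDistinct (fun j l => (hI j l).aemeasurable) hIind
    (by linarith) hV
  calc 1 - μ = (1 - D) * (1 - α) ^ K := by rw [hDdef]; field_simp; ring
    _ ≤ _ := mul_le_mul_of_nonneg_left hdist (by linarith)
    _ ≤ _ := hmain
    -- Monotonicity suffices: the final event need not be shown measurable.
    _ ≤ _ := measureReal_mono fun ω hω => ?_
  obtain ⟨hω1, hω2⟩ := hω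
  have hg : ∀ j, 0 < ((T (I ω) j).card : ℝ) * Var[id; ν] := fun j =>
    mul_pos (by exact_mod_cast hdpos.trans_le (hω1 j)) hν.1
  have hrip : ∀ j, Jobs.RowsRIP (A ω) (Finset.univ.image (I ω j)) (2 * s)
      ((T (I ω) j).card * Var[id; ν]) := fun j => hF m (A ω) _ _ (hg j) (hω2 j)
  refine ⟨?_, Jobs.jobsRecovers_of_rowsRIP hs (by omega) hK hg hrip⟩
  -- Enough because `2/9 < 0.4`.
  have h2 : (1.4 : ℝ) < √2 := Real.lt_sqrt_of_sq_lt (by norm_num)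
  have := Jobs.jobsRIPConst_le_of_rowsRIP (by omega) hg hrip
  norm_num at h2
  linarith
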